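/- Let $\mathfrak{A}$ be a finite-dimensional (complex) $C^*$-algebra; it has a unit, denoted $\mathbb{I}$. A state on $\mathfrak{A}$ is a linear functional $\omega:\mathfrak{A}\to\mathbb{C}$ with $\omega(A^*A)\ge 0$ for all $A\in\mathfrak{A}$ and $\omega(\mathbb{I})=\|\omega\|=1$; a state is pure if it is an extreme point of the convex set of states. For a probability vector $\vec p=(p_1,\dots,p_n)$ let $\mathrm{H}(\vec p)=-\sum_i p_i\log p_i$ (with $0\log 0=0$). For every state $\omega$ define its entropy as $$\mathcal{S}(\omega)=\inf\Big\{\mathrm{H}(\vec p)\,:\,\omega=\sum_{i=1}^n p_i\omega_i,\ n\in\mathbb{N},\ \vec p \text{ a probability vector},\ \omega_i \text{ pure states}\Big\},$$ where the set on the right is nonempty and bounded below. Then $\omega\mapsto\mathcal{S}(\omega)$ is a nonnegative concave function on the set of states, and it vanishes on pure states. Moreover, let $(\mathcal{H},\pi)$ be a representation of $\mathfrak{A}$ on a finite-dimensional Hilbert space (a linear map $\pi:\mathfrak{A}\to\mathcal{B}(\mathcal{H})$ preserving products and the involution) which is faithful ($\pi(A)=0$ if and only if $A=0$) and multiplicity-free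 (an orthogonal direct sum of pairwise unitarily inequivalent irreducible subrepresentations). Then for every state $\omega$ there is a unique density matrix (positive operator of trace one) $\rho_\omega\in\pi(\mathfrak{A})$ such that $\omega(A)=\operatorname{Tr}\bigl(\rho_\omega\,\pi(A)\bigr)$ for all $A\in\mathfrak{A}$, and $$\mathcal{S}(\omega)=\mathcal{S}_{\mathrm{VN}}(\rho_\omega),\qquad \mathcal{S}_{\mathrm{VN}}(\rho)=-\operatorname{Tr}(\rho\log\rho).$$ -/

import Mathlib

open scoped ComplexOrder

noncomputable section

namespace CStarEntropy

/-! ### States, pure states and the entropy of a state -/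

section States

variable (A : Type*) [NonUnitalCStarAlgebra A]

/-- The states of a C⋆-algebra: the positive linear functionals `ω` with `ω(𝟙) = ‖ω‖ = 1`, where
`𝟙` is the unit element. (The existence of a unit is not assumed here; every finite-dimensional
C⋆-algebra has one, and it is unique. Positivity is `0 ≤ ω (a⋆a)` in the order of `ℂ`, so
`ω (a⋆a)` is real and nonnegative.) -/
def stateSpace : Set (StrongDual ℂ A) :=
  {ω | (∀ a : A, 0 ≤ ω (star a * a)) ∧
    (∀ e : A, (∀ a : A, e * a = a ∧ a * e = a) → ω e = 1) ∧ ‖ω‖ = 1}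

/-- The pure states: the extreme points of the convex set of states. -/
def pureStates : Set (StrongDual ℂ A) :=
  Set.extremePoints ℝ (stateSpace A)

end States

/-- `p` is a probability vector of length `n`. -/
def IsProbVector {n : ℕ} (p : Fin n → ℝ) : Prop :=
  (∀ i, 0 ≤ p i) ∧ ∑ i, p i = 1

/-- The Shannon entropy `H(p) = -∑ pᵢ log pᵢ` (natural logarithm, `0 log 0 = 0`). -/
def shannonEntropy {n : ℕ} (p : Fin n → ℝ) : ℝ :=
  -∑ i, p i * Real.log (p i)

section Entropy

variable {A : Type*} [NonUnitalCStarAlgebra A]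

/-- The set of the Shannon entropies `H(p)` of all finite decompositions `ω = ∑ pᵢ ωᵢ` of `ω` into
pure states `ωᵢ` with `p` a probability vector. -/
def decompositionEntropies (ω : StrongDual ℂ A) : Set ℝ :=
  {h | ∃ (n : ℕ) (p : Fin n → ℝ) (φ : Fin n → StrongDual ℂ A),
    IsProbVector p ∧ (∀ i, φ i ∈ pureStates A) ∧ ω = ∑ i, p i • φ i ∧ h = shannonEntropy p}

/-- The entropy of a state: the infimum of the Shannon entropies of its decompositions into pure
states. -/
def entropy (ω : StrongDual ℂ A) : ℝ :=
  sInf (decompositionEntropies ω)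

end Entropy

/-! ### Representations -/

section Representations

variable {A : Type*} [NonUnitalCStarAlgebra A]
variable {H : Type*} [NormedAddCommGroup H] [InnerProductSpace ℂ H] [CompleteSpace H]

/-- The representation `π` is faithful: `π(a) = 0` if and only if `a = 0`. -/
def IsFaithful (π : A →⋆ₙₐ[ℂ] (H →L[ℂ] H)) : Prop :=
  ∀ a : A, π a = 0 ↔ a = 0

/-- The subspace `V` is invariant under `π`, i.e. it carries a subrepresentation. -/
def IsInvariant (π : A →⋆ₙₐ[ℂ] (H →L[ℂ] H)) (V : Submodule ℂ H) : Prop :=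
  ∀ a : A, ∀ v ∈ V, π a v ∈ V

/-- The subspace `V` carries an irreducible subrepresentation of `π`. -/
def IsIrreducibleSub (π : A →⋆ₙₐ[ℂ] (H →L[ℂ] H)) (V : Submodule ℂ H) : Prop :=
  IsInvariant π V ∧ V ≠ ⊥ ∧
    ∀ W : Submodule ℂ H, W ≤ V → IsInvariant π W → W = ⊥ ∨ W = V

/-- The subrepresentations of `π` on the invariant subspaces `V` and `W` are unitarily equivalent:
there is a unitary `U : V → W` with `U (π(a) v) = π(a) (U v)` for all `a` and all `v ∈ V`. -/
def AreEquivalentSubs (π : A →⋆ₙₐ[ℂ] (H →L[ℂ] H)) (V W : Submodule ℂ H) : Prop :=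
  ∃ U : V ≃ₗᵢ[ℂ] W, ∀ (a : A) (v v' : V), (v' : H) = π a (v : H) → (U v' : H) = π a (U v : H)

/-- The (finite-dimensional) representation `π` is multiplicity-free: it is the orthogonal direct
sum of finitely many pairwise inequivalent irreducible subrepresentations. -/
def IsMultiplicityFree (π : A →⋆ₙₐ[ℂ] (H →L[ℂ] H)) : Prop :=
  ∃ (N : ℕ) (V : Fin N → Submodule ℂ H),
    (∀ i, IsIrreducibleSub π (V i)) ∧
    (∀ i j, i ≠ j → V i ⟂ V j) ∧
    (⨆ i, V i) = ⊤ ∧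
    (∀ i j, i ≠ j → ¬ AreEquivalentSubs π (V i) (V j))

/-- The trace of an operator on a finite-dimensional Hilbert space. -/
def tr (T : H →L[ℂ] H) : ℂ :=
  LinearMap.trace ℂ H (T : H →ₗ[ℂ] H)

/-- A density matrix: a positive operator of trace one. -/
def IsDensityMatrix (ρ : H →L[ℂ] H) : Prop :=
  ρ.IsPositive ∧ tr ρ = 1

/-- The von Neumann entropy `-Tr(ρ log ρ)` of a density matrix on a finite-dimensional Hilbert
space. The logarithm is given by the functional calculus with `Real.log 0 = 0`, so `ρ log ρ`
vanishes on the kernel of `ρ` (the spectrum of `ρ` is finite, so every real function on it is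
continuous); the trace is real. -/
def vonNeumannEntropy (ρ : H →L[ℂ] H) : ℝ :=
  -(tr (ρ * CFC.log ρ)).re

/-- `ρ` is a density matrix which lies in the represented algebra `π(A)` and represents the state
`ω`, that is, `ω(a) = Tr(ρ π(a))` for all `a`. -/
def IsRepresentative (π : A →⋆ₙₐ[ℂ] (H →L[ℂ] H)) (ω : StrongDual ℂ A) (ρ : H →L[ℂ] H) : Prop :=
  IsDensityMatrix ρ ∧ ρ ∈ Set.range π ∧ ∀ a : A, ω a = tr (ρ * π a)

end Representations

end CStarEntropy

end

noncomputable section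

universe u

namespace CStarEntropy

/-! ### The unit and the trace of a finite-dimensional C⋆-algebra -/

section Algebra

variable {A : Type*} [NonUnitalCStarAlgebra A]

/-! In a faithful multiplicity-free representation, Schur's lemma makes the commutant scalar on each
irreducible block, and Jacobson density then puts every block-preserving operator, cut down by the
projection `π e`, into the range of `π`. The cut is needed because `π` may be degenerate. The trace
pairing on the range is nondegenerate, so each functional has a unique representative there. For a
state it is a density matrix, diagonalizable by vectors lying in single blocks. Hence the pure
states are exactly the vector states of unit block vectors fixed by `π e` (`pureStates_eq`), and
decomposing a state means writing `ρ` as a mixture of rank-one projections `∑ pᵢ |ψᵢ⟩⟨ψᵢ|`. The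
spectral mixture attains the von Neumann entropy. For any other, `pᵢ |ψᵢ⟩⟨ψᵢ| ≤ ρ` gives `pᵢ ⟨ψᵢ,
ρ⁻¹ψᵢ⟩ ≤ 1`, with the inverse taken to be zero on the kernel, and `log t ≤ t - 1` turns this into
`S(ρ) ≤ H(p)`. Concavity is that of `-x log x` in an eigenbasis of the mixture, combined with the
Peierls inequality. A suitable representation always exists: apply GNS to the trace of left
multiplication and keep one summand from each equivalence class. -/

/-- `e` is a two-sided unit element of `A`. -/
def IsUnitElement (e : A) : Prop :=
  ∀ a : A, e * a = a ∧ a * e = a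

/-- In finite dimension the closed unit ball is compact, so an approximate unit has a cluster point,
and limits along it identify this point as a unit. -/
theorem exists_isUnitElement [FiniteDimensional ℂ A] : ∃ e : A, IsUnitElement e := by
  let _ := CStarAlgebra.spectralOrder A
  have _ := CStarAlgebra.spectralOrderedRing A
  have : ProperSpace A := FiniteDimensional.proper ℂ A
  have hl := CStarAlgebra.increasingApproximateUnit A
  obtain ⟨e, -, he⟩ := (isCompact_closedBall (0 : A) 1).exists_clusterPt
    (Filter.le_principal_iff.mpr hl.closedBall_mem)
  have : (nhds e ⊓ CStarAlgebra.approximateUnit A).NeBot := he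
  refine ⟨e, fun a => ⟨?_, ?_⟩⟩
  · refine tendsto_nhds_unique ?_ ((hl.tendsto_mul_right a).mono_left (inf_le_right (a := nhds e)))
    exact ((continuous_id.mul continuous_const).tendsto e).mono_left inf_le_left
  · refine tendsto_nhds_unique ?_ ((hl.tendsto_mul_left a).mono_left (inf_le_right (a := nhds e)))
    exact ((continuous_const.mul continuous_id).tendsto e).mono_left inf_le_left

theorem IsUnitElement.unique {e e' : A} (h : IsUnitElement e) (h' : IsUnitElement e') : e = e' := by
  rw [← (h' e).1, (h e').2]

theorem IsUnitElement.star_eq {e : A} (h : IsUnitElement e) : star e = e := by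
  have h1 := (h (star e)).1
  have h2 := congrArg star h1
  rw [star_mul, star_star, h1] at h2
  exact h2

theorem IsUnitElement.star_mul_self {e : A} (h : IsUnitElement e) : star e * e = e := by
  rw [h.star_eq, (h e).1]

theorem IsUnitElement.norm_le_one {e : A} (h : IsUnitElement e) : ‖e‖ ≤ 1 := by
  have h1 := CStarRing.norm_star_mul_self (x := e)
  rw [h.star_mul_self] at h1
  nlinarith [norm_nonneg e]

/-- The trace of left multiplication. -/
def regularTrace (A : Type*) [NonUnitalCStarAlgebra A] : A →ₗ[ℂ] ℂ :=
  LinearMap.trace ℂ A ∘ₗ LinearMap.mul ℂ A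

theorem regularTrace_apply (b : A) :
    regularTrace A b = LinearMap.trace ℂ A (LinearMap.mulLeft ℂ b) := rfl

theorem regularTrace_eq_sum_roots [FiniteDimensional ℂ A] (b : A) :
    regularTrace A b = (LinearMap.mulLeft ℂ b).charpoly.roots.sum := by
  rw [regularTrace_apply]
  exact Module.End.trace_eq_sum_roots_charpoly_of_splits (IsAlgClosed.splits _)

section Order

variable [PartialOrder A] [StarOrderedRing A]

theorem nonneg_of_smul_nonneg {μ : ℂ} {p : A} (hp : 0 ≤ p) (hp0 : p ≠ 0) (h : 0 ≤ μ • p) :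
    0 ≤ μ := by
  have h1 : star (μ • p) = μ • p := (IsSelfAdjoint.of_nonneg h).star_eq
  rw [star_smul, (IsSelfAdjoint.of_nonneg hp).star_eq] at h1
  have h2 : star μ = μ := smul_left_injective ℂ hp0 h1
  obtain ⟨r, rfl⟩ : ∃ r : ℝ, (r : ℂ) = μ := Complex.conj_eq_iff_real.mp h2 |>.imp fun _ h => h.symm
  by_contra hr
  have hr' : r < 0 := by simpa using hr
  have h3 : (0 : A) ≤ (-r) • p := smul_nonneg (by linarith) hp
  have h4 : ((r : ℂ)) • p = r • p := by simp
  rw [h4] at h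
  have h5 : r • p = 0 := le_antisymm (by simpa using h3) h
  rcases smul_eq_zero.mp h5 with h6 | h6
  · exact hr'.ne h6
  · exact hp0 h6

/-- Conjugation gives `x⋆ b x = μ x⋆ x`, with both sides positive and `x⋆ x` nonzero. -/
theorem nonneg_of_mul_eq_smul {b x : A} {μ : ℂ} (hb : 0 ≤ b) (hx : x ≠ 0) (h : b * x = μ • x) :
    0 ≤ μ := by
  refine nonneg_of_smul_nonneg (star_mul_self_nonneg x) ?_ (p := star x * x) ?_
  · simpa [CStarRing.star_mul_self_eq_zero_iff] using hx
  · have := star_left_conjugate_nonneg hb x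
    rwa [mul_assoc, h, mul_smul_comm] at this

variable [FiniteDimensional ℂ A]

theorem nonneg_of_mem_roots_charpoly {b : A} (hb : 0 ≤ b) {μ : ℂ}
    (hμ : μ ∈ (LinearMap.mulLeft ℂ b).charpoly.roots) : 0 ≤ μ := by
  have h1 := Polynomial.isRoot_of_mem_roots hμ
  rw [← Module.End.hasEigenvalue_iff_isRoot_charpoly] at h1
  obtain ⟨x, hx⟩ := h1.exists_hasEigenvector
  exact nonneg_of_mul_eq_smul hb hx.2 (by simpa using hx.apply_eq_smul)

theorem regularTrace_nonneg {b : A} (hb : 0 ≤ b) : 0 ≤ regularTrace A b := by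
  rw [regularTrace_eq_sum_roots]
  exact Multiset.sum_nonneg fun μ hμ => nonneg_of_mem_roots_charpoly hb hμ

/-- The eigenvalues of left multiplication by `b` are nonnegative with sum zero, so all vanish and
Cayley–Hamilton makes it nilpotent. The C⋆-identity excludes nonzero nilpotents here. -/
theorem eq_zero_of_regularTrace_eq_zero {b : A} (hb : 0 ≤ b) (h : regularTrace A b = 0) :
    b = 0 := by
  set T := LinearMap.mulLeft ℂ b with hT
  have hsa : star b = b := (IsSelfAdjoint.of_nonneg hb).star_eq
  have hroots : ∀ μ ∈ T.charpoly.roots, μ = 0 := by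
    rw [regularTrace_eq_sum_roots] at h
    exact Multiset.all_zero_of_le_zero_le_of_sum_eq_zero
      (fun μ hμ => nonneg_of_mem_roots_charpoly hb hμ) h
  have hpoly : T.charpoly = Polynomial.X ^ T.charpoly.roots.card := by
    have h1 := (IsAlgClosed.splits T.charpoly).eq_prod_roots_of_monic T.charpoly_monic
    rw [Multiset.eq_replicate_card.mpr hroots] at h1
    conv_lhs => rw [h1]
    simp
  -- Lower the exponent one at a time: `b (b y) = 0` gives `(b y)⋆ (b y) = 0`, since `b` is
  -- self-adjoint.
  have hnil : ∀ n, T ^ n = 0 → T = 0 ∨ n = 0 := by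
    intro n
    induction n with
    | zero => simp
    | succ n ih =>
      intro hn
      rcases Nat.eq_zero_or_pos n with rfl | hpos
      · exact Or.inl (by simpa using hn)
      · obtain ⟨m, rfl⟩ : ∃ m, n = m + 1 := ⟨n - 1, by omega⟩
        refine Or.inl ((ih ?_).resolve_right (by omega))
        ext x
        have h2 := LinearMap.congr_fun hn x
        rw [pow_succ', pow_succ', Module.End.mul_apply, Module.End.mul_apply] at h2
        rw [pow_succ', Module.End.mul_apply]
        set y := (T ^ m) x
        have h3 : b * (b * y) = 0 := by simpa [hT] using h2
        have h4 : star (b * y) * (b * y) = 0 := by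
          rw [star_mul, hsa, mul_assoc, h3, mul_zero]
        simpa [hT] using (CStarRing.star_mul_self_eq_zero_iff _).mp h4
  have hCH := T.aeval_self_charpoly
  rw [hpoly] at hCH
  simp only [map_pow, Polynomial.aeval_X] at hCH
  have hbb : star b * b = 0 := by
    rw [hsa]
    rcases hnil _ hCH with h5 | h5
    · simpa [hT] using LinearMap.congr_fun h5 b
    -- Exponent zero means that the identity map of `A` is zero.
    · rw [h5, pow_zero] at hCH
      simpa using LinearMap.congr_fun hCH (b * b)
  exact (CStarRing.star_mul_self_eq_zero_iff _).mp hbb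

end Order

end Algebra

/-! ### Invariant subspaces and subrepresentations -/

section InvariantSubspaces

theorem eq_zero_of_forall_orthogonal {ι H : Type*} [NormedAddCommGroup H]
    [InnerProductSpace ℂ H] {V : ι → Submodule ℂ H} (hV : ⨆ i, V i = ⊤)
    {y : H} (h : ∀ i, ∀ v ∈ V i, inner ℂ v y = 0) : y = 0 := by
  have h1 : (⨆ i, V i) ≤ (ℂ ∙ y)ᗮ :=
    iSup_le fun i v hv => Submodule.mem_orthogonal_singleton_iff_inner_left.mpr (h i v hv)
  rw [hV] at h1
  have h2 := h1 (Submodule.mem_top (x := y))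
  rw [Submodule.mem_orthogonal_singleton_iff_inner_left] at h2
  exact inner_self_eq_zero.mp h2

variable {A : Type*} [NonUnitalCStarAlgebra A]
variable {H : Type*} [NormedAddCommGroup H] [InnerProductSpace ℂ H] [CompleteSpace H]
variable {π : A →⋆ₙₐ[ℂ] (H →L[ℂ] H)}

theorem inner_map_left (π : A →⋆ₙₐ[ℂ] (H →L[ℂ] H)) (a : A) (x y : H) :
    inner ℂ (π a x) y = inner ℂ x (π (star a) y) := by
  rw [map_star, ContinuousLinearMap.star_eq_adjoint, ContinuousLinearMap.adjoint_inner_right]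

theorem IsInvariant.orthogonal {V : Submodule ℂ H} (hV : IsInvariant π V) :
    IsInvariant π Vᗮ := by
  intro a v hv
  rw [Submodule.mem_orthogonal] at hv ⊢
  intro u hu
  have := hv _ (hV (star a) u hu)
  rwa [inner_map_left, star_star] at this

theorem IsInvariant.inf {V W : Submodule ℂ H} (hV : IsInvariant π V) (hW : IsInvariant π W) :
    IsInvariant π (V ⊓ W) :=
  fun a v hv => ⟨hV a v hv.1, hW a v hv.2⟩

theorem isInvariant_sSup {s : Set (Submodule ℂ H)} (h : ∀ V ∈ s, IsInvariant π V) :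
    IsInvariant π (sSup s) := by
  intro a
  have : sSup s ≤ (sSup s).comap (π a : H →ₗ[ℂ] H) :=
    sSup_le fun V hV v hv => le_sSup hV (h V hV a v hv)
  exact fun v hv => this hv

theorem exists_irreducibleSub_le [FiniteDimensional ℂ H] {W : Submodule ℂ H}
    (hW : IsInvariant π W) (h0 : W ≠ ⊥) : ∃ V ≤ W, IsIrreducibleSub π V := by
  obtain ⟨V, hV⟩ := exists_minimal_of_wellFoundedLT
    (fun V : Submodule ℂ H => V ≤ W ∧ IsInvariant π V ∧ V ≠ ⊥) ⟨W, le_rfl, hW, h0⟩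
  refine ⟨V, hV.prop.1, hV.prop.2.1, hV.prop.2.2, fun U hU hUi => ?_⟩
  by_cases hU0 : U = ⊥
  · exact Or.inl hU0
  · exact Or.inr (hV.eq_of_le ⟨hU.trans hV.prop.1, hUi, hU0⟩ hU)

/-- Orthogonal complements of invariant subspaces are invariant, so an irreducible piece splits off
and the rest is strictly smaller. -/
theorem exists_orthogonal_decomposition [FiniteDimensional ℂ H] (W : Submodule ℂ H)
    (hW : IsInvariant π W) : ∃ s : Finset (Submodule ℂ H),
      (∀ V ∈ s, IsIrreducibleSub π V) ∧ (∀ V ∈ s, ∀ U ∈ s, V ≠ U → V ⟂ U) ∧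
      sSup (s : Set (Submodule ℂ H)) = W := by
  classical
  induction W using WellFoundedLT.induction with
  | ind W ih =>
    by_cases h0 : W = ⊥
    · exact ⟨∅, by simp, by simp, by simp [h0]⟩
    obtain ⟨V, hVW, hV⟩ := exists_irreducibleSub_le hW h0
    have hsup : V ⊔ (W ⊓ Vᗮ) = W := by
      rw [inf_comm]
      exact Submodule.sup_orthogonal_inf_of_hasOrthogonalProjection hVW
    have hlt : W ⊓ Vᗮ < W := by
      refine lt_of_le_of_ne inf_le_left fun h => hV.2.1 ?_
      have h1 : V ≤ Vᗮ := hVW.trans (inf_eq_left.mp h)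
      exact (Submodule.isOrtho_self).mp h1
    obtain ⟨s, hs1, hs2, hs3⟩ := ih _ hlt (hW.inf hV.1.orthogonal)
    have hort : ∀ U ∈ s, V ⟂ U := fun U hU =>
      (Submodule.isOrtho_iff_le.mpr <|
        (le_sSup (Finset.mem_coe.mpr hU)).trans (hs3.le.trans inf_le_right)).symm
    refine ⟨insert V s, ?_, ?_, ?_⟩
    · simpa using ⟨hV, hs1⟩
    · intro U hU U' hU' hne
      rcases Finset.mem_insert.mp hU with rfl | h <;>
        rcases Finset.mem_insert.mp hU' with rfl | h'
      · exact absurd rfl hne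
      · exact hort _ h'
      · exact (hort _ h).symm
      · exact hs2 _ h _ h' hne
    · rw [Finset.coe_insert, sSup_insert, hs3, hsup]

/-- Equivalent subrepresentations have the same kernel, so discarding repeated summands preserves
faithfulness. -/
theorem AreEquivalentSubs.eq_zero_of_left {V W : Submodule ℂ H} (h : AreEquivalentSubs π V W)
    {a : A} (ha : ∀ v ∈ V, π a v = 0) : ∀ w ∈ W, π a w = 0 := by
  obtain ⟨U, hU⟩ := h
  intro w hw
  obtain ⟨v, hv⟩ := U.surjective ⟨w, hw⟩
  have := hU a v 0 (by simp [ha v v.2])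
  rw [hv] at this
  simpa using this.symm

theorem AreEquivalentSubs.eq_zero_of_right {V W : Submodule ℂ H} (h : AreEquivalentSubs π V W)
    (hV : IsInvariant π V) {a : A} (ha : ∀ w ∈ W, π a w = 0) : ∀ v ∈ V, π a v = 0 := by
  obtain ⟨U, hU⟩ := h
  intro v hv
  have := hU a ⟨v, hv⟩ ⟨π a v, hV a v hv⟩ rfl
  rw [ha _ (U ⟨v, hv⟩).2] at this
  simpa using this

variable [FiniteDimensional ℂ H]

/-- The restriction of a representation to an invariant subspace. -/
def subrepresentation (π : A →⋆ₙₐ[ℂ] (H →L[ℂ] H)) (K : Submodule ℂ H) (hK : IsInvariant π K) :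
    A →⋆ₙₐ[ℂ] (K →L[ℂ] K) where
  toFun a := ((π a).comp K.subtypeL).codRestrict K fun v => hK a v v.2
  map_smul' c a := by ext; simp; rfl
  map_zero' := by ext; simp
  map_add' a b := by ext; simp; rfl
  map_mul' a b := by ext; simp; rfl
  map_star' a := by
    rw [ContinuousLinearMap.star_eq_adjoint, ContinuousLinearMap.eq_adjoint_iff]
    intro x y
    change inner ℂ (π (star a) x : H) y = inner ℂ (x : H) (π a y)
    rw [inner_map_left, star_star]

@[simp]
theorem coe_subrepresentation_apply (K : Submodule ℂ H) (hK : IsInvariant π K) (a : A) (v : K) :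
    (subrepresentation π K hK a v : H) = π a v := rfl

theorem IsIrreducibleSub.comap_subtype {K V : Submodule ℂ H} (hK : IsInvariant π K) (hVK : V ≤ K)
    (hV : IsIrreducibleSub π V) :
    IsIrreducibleSub (subrepresentation π K hK) (V.comap K.subtype) := by
  have hmap : (V.comap K.subtype).map K.subtype = V := by
    rw [Submodule.map_comap_subtype, inf_eq_right.mpr hVK]
  have hinj := Submodule.map_injective_of_injective K.injective_subtype
  refine ⟨fun a v hv => hV.1 a v hv, fun h => hV.2.1 ?_, fun W hW hWi => ?_⟩
  · rw [← hmap, h, Submodule.map_bot]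
  · have h1 : IsInvariant π (W.map K.subtype) := by
      rintro a _ ⟨v, hv, rfl⟩
      exact ⟨_, hWi a v hv, rfl⟩
    rcases hV.2.2 _ ((Submodule.map_mono hW).trans hmap.le) h1 with h2 | h2
    · exact Or.inl (hinj (h2.trans (Submodule.map_bot _).symm))
    · exact Or.inr (hinj (h2.trans hmap.symm))

theorem AreEquivalentSubs.of_comap_subtype {K V W : Submodule ℂ H} (hK : IsInvariant π K)
    (hVK : V ≤ K) (hWK : W ≤ K)
    (h : AreEquivalentSubs (subrepresentation π K hK) (V.comap K.subtype) (W.comap K.subtype)) :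
    AreEquivalentSubs π V W := by
  obtain ⟨U, hU⟩ := h
  let e : ∀ V : Submodule ℂ H, V ≤ K → V.comap K.subtype ≃ₗᵢ[ℂ] V := fun V hV =>
    ⟨Submodule.comapSubtypeEquivOfLe hV, fun x => rfl⟩
  have he : ∀ (V : Submodule ℂ H) hV x, ((e V hV x : V) : H) = ((x : K) : H) := fun _ _ _ => rfl
  refine ⟨(e V hVK).symm.trans (U.trans (e W hWK)), fun a v v' hv => ?_⟩
  obtain ⟨x, rfl⟩ := (e V hVK).surjective v
  obtain ⟨x', rfl⟩ := (e V hVK).surjective v'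
  rw [he, he] at hv
  simp only [LinearIsometryEquiv.trans_apply, LinearIsometryEquiv.symm_apply_apply, he]
  have := hU a x x' (Subtype.ext hv)
  rw [this, coe_subrepresentation_apply]

theorem isMultiplicityFree_subrepresentation {s : Finset (Submodule ℂ H)}
    (hs : ∀ V ∈ s, IsIrreducibleSub π V) (hort : ∀ V ∈ s, ∀ U ∈ s, V ≠ U → V ⟂ U)
    (hne : ∀ V ∈ s, ∀ U ∈ s, V ≠ U → ¬ AreEquivalentSubs π V U)
    {K : Submodule ℂ H} (hK : IsInvariant π K) (hsK : sSup (s : Set (Submodule ℂ H)) = K) :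
    IsMultiplicityFree (subrepresentation π K hK) := by
  have hle : ∀ V ∈ s, V ≤ K := fun V hV => hsK ▸ le_sSup (Finset.mem_coe.mpr hV)
  let f : Fin s.card ≃ s := s.equivFin.symm
  have hf : ∀ i j, i ≠ j → (f i : Submodule ℂ H) ≠ f j := fun i j hij h =>
    hij (f.injective (Subtype.ext h))
  refine ⟨s.card, fun i => (f i : Submodule ℂ H).comap K.subtype, fun i => ?_, fun i j hij => ?_,
    ?_, fun i j hij h => ?_⟩
  · exact (hs _ (f i).2).comap_subtype hK (hle _ (f i).2)
  · rw [Submodule.isOrtho_iff_inner_eq]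
    intro u hu v hv
    exact Submodule.isOrtho_iff_inner_eq.mp (hort _ (f i).2 _ (f j).2 (hf i j hij)) u hu v hv
  · apply Submodule.map_injective_of_injective K.injective_subtype
    have h1 : ∀ i, ((f i : Submodule ℂ H).comap K.subtype).map K.subtype = f i := fun i => by
      rw [Submodule.map_comap_subtype, inf_eq_right.mpr (hle _ (f i).2)]
    rw [Submodule.map_iSup, Submodule.map_top, Submodule.range_subtype, iSup_congr h1,
      f.iSup_comp (g := fun V : s => (V : Submodule ℂ H)), ← hsK, sSup_eq_iSup']
    rfl
  · exact hne _ (f i).2 _ (f j).2 (hf i j hij)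
      (h.of_comap_subtype hK (hle _ (f i).2) (hle _ (f j).2))

/-- Keep a maximal pairwise inequivalent family of summands. An element killing these also kills
every discarded summand, which is equivalent to a kept one. -/
theorem exists_multiplicityFree_subrepresentation (hπ : IsFaithful π) :
    ∃ (K : Submodule ℂ H) (hK : IsInvariant π K),
      IsFaithful (subrepresentation π K hK) ∧
      IsMultiplicityFree (subrepresentation π K hK) := by
  classical
  obtain ⟨s, hs1, hs2, hs3⟩ := exists_orthogonal_decomposition (π := π) ⊤
    fun _ _ _ => Submodule.mem_top
  obtain ⟨t, ht⟩ := exists_maximal_of_wellFoundedGT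
    (fun t : Finset s => ∀ V ∈ t, ∀ U ∈ t, V ≠ U → ¬ AreEquivalentSubs π V.1 U.1)
    ⟨∅, by simp⟩
  let t' : Finset (Submodule ℂ H) := t.map (Function.Embedding.subtype _)
  have hmem : ∀ V, V ∈ t' → ∃ h : V ∈ s, (⟨V, h⟩ : s) ∈ t := by
    intro V hV
    simpa [t'] using hV
  have hK : IsInvariant π (sSup (t' : Set (Submodule ℂ H))) :=
    isInvariant_sSup fun V hV => (hs1 V (hmem V hV).1).1
  refine ⟨_, hK, fun a => ⟨fun ha => ?_, fun ha => by rw [ha, map_zero]⟩,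
    isMultiplicityFree_subrepresentation (fun V hV => hs1 V (hmem V hV).1)
      (fun V hV U hU => hs2 V (hmem V hV).1 U (hmem U hU).1)
      (fun V hV U hU hne => ht.prop _ (hmem V hV).2 _ (hmem U hU).2
        fun h => hne (congrArg Subtype.val h)) hK rfl⟩
  have hkill : ∀ V : s, V ∈ t → ∀ v ∈ V.1, π a v = 0 := by
    intro V hV v hv
    have hvK : v ∈ sSup (t' : Set (Submodule ℂ H)) :=
      le_sSup (a := V.1) (by simpa [t'] using hV) hv
    have := congrArg (fun T => ((T ⟨v, hvK⟩ : _) : H)) ha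
    simpa using this
  have hall : ∀ V : s, ∀ v ∈ V.1, π a v = 0 := by
    intro V
    by_cases hV : V ∈ t
    · exact hkill V hV
    -- By maximality, adding `V` creates an equivalent pair, and `V` must be one of its members, on
    -- either side.
    have hnot : ¬ ∀ W ∈ insert V t, ∀ U ∈ insert V t, W ≠ U → ¬ AreEquivalentSubs π W.1 U.1 :=
      fun h => hV (ht.le_of_ge h (Finset.subset_insert V t) (Finset.mem_insert_self V t))
    push Not at hnot
    obtain ⟨W, hW, U, hU, hne, heq⟩ := hnot
    rcases Finset.mem_insert.mp hW with rfl | hW' <;>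
      rcases Finset.mem_insert.mp hU with rfl | hU'
    · exact absurd rfl hne
    · exact heq.eq_zero_of_right (hs1 _ W.2).1 (hkill U hU')
    · exact heq.eq_zero_of_left (hkill W hW')
    · exact absurd heq (ht.prop W hW' U hU' hne)
  refine (hπ a).mp (ContinuousLinearMap.ext fun v => ?_)
  have h1 : sSup (s : Set (Submodule ℂ H)) ≤ LinearMap.ker (π a : H →ₗ[ℂ] H) :=
    sSup_le fun V hV v hv => hall ⟨V, hV⟩ v hv
  rw [hs3] at h1
  exact h1 (Submodule.mem_top (x := v))

end InvariantSubspaces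

/-! ### Existence: the GNS representation of the regular trace -/

section Existence

open PositiveLinearMap

/-- Every finite-dimensional C⋆-algebra has a faithful multiplicity-free representation: a
subrepresentation of the GNS representation of the trace of left multiplication. -/
theorem exists_faithful_multiplicityFree (A : Type u) [NonUnitalCStarAlgebra A]
    [FiniteDimensional ℂ A] :
    ∃ (H : Type u) (_ : NormedAddCommGroup H) (_ : InnerProductSpace ℂ H) (_ : CompleteSpace H)
      (_ : FiniteDimensional ℂ H) (π : A →⋆ₙₐ[ℂ] (H →L[ℂ] H)),
      IsFaithful π ∧ IsMultiplicityFree π := by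
  let _ := CStarAlgebra.spectralOrder A
  have _ := CStarAlgebra.spectralOrderedRing A
  let f : A →ₚ[ℂ] ℂ := PositiveLinearMap.mk₀ (regularTrace A) fun b hb => regularTrace_nonneg hb
  have hfin : FiniteDimensional ℂ f.PreGNS := inferInstanceAs (FiniteDimensional ℂ A)
  have hfin' : FiniteDimensional ℂ f.GNS := by
    let g : f.PreGNS →ₗ[ℂ] f.GNS := (UniformSpace.Completion.toComplL (𝕜 := ℂ) (E := f.PreGNS))
    have hc : IsClosed (LinearMap.range g : Set f.GNS) := Submodule.closed_of_finiteDimensional _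
    have hd : Dense (LinearMap.range g : Set f.GNS) :=
      UniformSpace.Completion.denseRange_coe
    -- The image of the pre-GNS space is dense, and closed because it is finite-dimensional, so
    -- completion adds nothing.
    refine Module.Finite.of_surjective g fun x => ?_
    have : x ∈ closure (LinearMap.range g : Set f.GNS) := hd x
    rwa [hc.closure_eq] at this
  have hfaith : IsFaithful f.gnsNonUnitalStarAlgHom := by
    refine fun a => ⟨fun ha => ?_, fun ha => by rw [ha, map_zero]⟩
    obtain ⟨e, he⟩ := exists_isUnitElement (A := A)
    -- The image of the vector `e` under `π a` has squared norm `f (a⋆ a)`, so faithfulness of the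
    -- trace applies.
    have h1 : f.gnsNonUnitalStarAlgHom a (f.toPreGNS e : f.GNS) = 0 := by rw [ha]; rfl
    rw [gnsNonUnitalStarAlgHom_apply_coe] at h1
    have h2 : ‖f.leftMulMapPreGNS a (f.toPreGNS e)‖ = 0 := by
      rw [← UniformSpace.Completion.norm_coe, h1, norm_zero]
    have h3 := preGNS_norm_sq f (f.leftMulMapPreGNS a (f.toPreGNS e))
    rw [h2] at h3
    simp only [leftMulMapPreGNS_apply, ofPreGNS_toPreGNS, (he a).2] at h3
    have h4 := eq_zero_of_regularTrace_eq_zero (star_mul_self_nonneg a)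
      (show f (star a * a) = 0 by simpa using h3.symm)
    exact (CStarRing.star_mul_self_eq_zero_iff _).mp h4
  obtain ⟨K, hK, h1, h2⟩ := exists_multiplicityFree_subrepresentation hfaith
  exact ⟨K, inferInstance, inferInstance, inferInstance, inferInstance, _, h1, h2⟩

end Existence

/-! ### Schur's lemma and the range of a multiplicity-free representation -/

section Schur

variable {A : Type*} [NonUnitalCStarAlgebra A]
variable {H : Type*} [NormedAddCommGroup H] [InnerProductSpace ℂ H] [CompleteSpace H]
variable [FiniteDimensional ℂ H]
variable {π : A →⋆ₙₐ[ℂ] (H →L[ℂ] H)}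

/-- An eigenspace of the restriction is nonzero and invariant, hence all of `V`. -/
theorem IsIrreducibleSub.exists_eq_smul {V : Submodule ℂ H} (hV : IsIrreducibleSub π V)
    {S : H →L[ℂ] H} (hS : ∀ a, ∀ v ∈ V, S (π a v) = π a (S v)) (hSV : ∀ v ∈ V, S v ∈ V) :
    ∃ c : ℂ, ∀ v ∈ V, S v = c • v := by
  let T : Module.End ℂ V := (S : H →ₗ[ℂ] H).restrict hSV
  have : Nontrivial V := Submodule.nontrivial_iff_ne_bot.mpr hV.2.1
  obtain ⟨c, hc⟩ := Module.End.exists_eigenvalue T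
  have hmem : ∀ v : V, v ∈ T.eigenspace c ↔ S v = c • (v : H) := fun v => by
    rw [Module.End.mem_eigenspace_iff, Subtype.ext_iff]
    rfl
  refine ⟨c, ?_⟩
  have hinv : IsInvariant π ((T.eigenspace c).map V.subtype) := by
    rintro a _ ⟨v, hv, rfl⟩
    refine ⟨⟨π a v, hV.1 a v v.2⟩, ?_, rfl⟩
    rw [SetLike.mem_coe, hmem] at hv ⊢
    simp only [hS a v v.2, hv, map_smul]
  rcases hV.2.2 _ (Submodule.map_subtype_le _ _) hinv with h | h
  · exact absurd (Submodule.map_injective_of_injective V.injective_subtype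
      (h.trans (Submodule.map_bot _).symm)) hc
  · intro v hv
    rw [← h] at hv
    obtain ⟨w, hw, rfl⟩ := hv
    exact (hmem w).mp hw

theorem IsInvariant.starProjection_comm {V : Submodule ℂ H} (hV : IsInvariant π V) (a : A)
    (x : H) : V.starProjection (π a x) = π a (V.starProjection x) := by
  refine Submodule.eq_starProjection_of_mem_of_inner_eq_zero
    (hV a _ (Submodule.starProjection_apply_mem _ _)) ?_
  intro w hw
  rw [← map_sub, inner_map_left]
  exact Submodule.starProjection_inner_eq_zero x _ (hV _ w hw)

/-- **Schur's lemma** for intertwiners of irreducible subrepresentations that are not unitarily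
equivalent. -/
theorem IsIrreducibleSub.eq_zero_of_not_areEquivalentSubs {V W : Submodule ℂ H}
    (hV : IsIrreducibleSub π V) (hW : IsIrreducibleSub π W) (hne : ¬ AreEquivalentSubs π V W)
    {S : H →L[ℂ] H} (hS : ∀ a v, S (π a v) = π a (S v)) (hSV : ∀ v ∈ V, S v ∈ W) :
    ∀ v ∈ V, S v = 0 := by
  -- `S⋆ S` compressed to `V` is an intertwiner of `V` with itself, hence a scalar `c`, so `‖S v‖² =
  -- c ‖v‖²` on `V`.
  let D : H →L[ℂ] H := V.starProjection * (ContinuousLinearMap.adjoint S * S)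
  have hadj : ∀ a x, ContinuousLinearMap.adjoint S (π a x) =
      π a (ContinuousLinearMap.adjoint S x) := by
    intro a x
    refine ext_inner_left ℂ fun y => ?_
    rw [ContinuousLinearMap.adjoint_inner_right, ← star_star a, ← inner_map_left,
      ← inner_map_left, ContinuousLinearMap.adjoint_inner_right, hS]
  obtain ⟨c, hc⟩ := hV.exists_eq_smul (S := D)
    (fun a v _ => by simp [D, hS, hadj, hV.1.starProjection_comm]) (fun v _ => by simp [D])
  have hinner : ∀ v ∈ V, inner ℂ (S v) (S v) = c * inner ℂ v v := by
    intro v hv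
    have h1 := hc v hv
    have h2 : inner ℂ v (D v) = inner ℂ (S v) (S v) := by
      change inner ℂ v (V.starProjection (ContinuousLinearMap.adjoint S (S v))) = _
      rw [← Submodule.inner_starProjection_left_eq_right,
        Submodule.starProjection_eq_self_iff.mpr hv, ContinuousLinearMap.adjoint_inner_right]
    rw [← h2, h1, inner_smul_right]
  obtain ⟨u, hu, hu0⟩ := Submodule.exists_mem_ne_zero_of_ne_bot hV.2.1
  obtain ⟨r, hr⟩ : ∃ r : ℝ, c = r := by
    have h1 := hinner u hu
    rw [inner_self_eq_norm_sq_to_K, inner_self_eq_norm_sq_to_K] at h1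
    have h3 : ((‖u‖ : ℂ)) ^ 2 ≠ 0 := pow_ne_zero _ (by simpa using hu0)
    refine ⟨‖S u‖ ^ 2 / ‖u‖ ^ 2, ?_⟩
    push_cast
    rw [eq_div_iff h3]
    exact h1.symm
  have hnorm : ∀ v ∈ V, ‖S v‖ ^ 2 = r * ‖v‖ ^ 2 := by
    intro v hv
    have h1 := hinner v hv
    rw [inner_self_eq_norm_sq_to_K, inner_self_eq_norm_sq_to_K, hr] at h1
    exact Complex.ofReal_injective (by push_cast; exact h1)
  by_contra hnot
  push Not at hnot
  obtain ⟨w, hw, hSw⟩ := hnot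
  have hrpos : 0 < r := by
    have h1 := hnorm w hw
    have h2 : 0 < ‖S w‖ ^ 2 := by positivity
    by_contra hr0
    nlinarith [sq_nonneg ‖w‖]
  -- If `S` is nonzero on `V`, this rescaling makes it isometric. Its image is nonzero and
  -- invariant, so it fills `W`, contradicting inequivalence.
  let t : ℝ := (Real.sqrt r)⁻¹
  have ht : 0 < t := by positivity
  let L : V →ₗ[ℂ] W := (((t : ℂ) • (S : H →ₗ[ℂ] H)) : H →ₗ[ℂ] H).restrict
    fun v hv => W.smul_mem _ (hSV v hv)
  have hL : ∀ v : V, ((L v : W) : H) = (t : ℂ) • S v := fun v => rfl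
  let Li : V →ₗᵢ[ℂ] W := ⟨L, fun v => by
    rw [Submodule.coe_norm, hL, norm_smul, Submodule.coe_norm]
    have h1 : ‖S v‖ = Real.sqrt r * ‖(v : H)‖ := by
      rw [← Real.sqrt_sq (norm_nonneg (S v)), hnorm v v.2, Real.sqrt_mul hrpos.le,
        Real.sqrt_sq (norm_nonneg _)]
    rw [h1]
    simp only [Complex.norm_real, Real.norm_eq_abs, abs_of_pos ht, t]
    field_simp⟩
  have hsurj : Function.Surjective Li := by
    have hinv : IsInvariant π ((LinearMap.range L).map W.subtype) := by
      rintro a _ ⟨_, ⟨v, rfl⟩, rfl⟩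
      refine ⟨_, ⟨⟨π a v, hV.1 a v v.2⟩, rfl⟩, ?_⟩
      simp [hL, hS]
    rcases hW.2.2 _ (Submodule.map_subtype_le _ _) hinv with h | h
    · replace h := LinearMap.range_eq_bot.mp (Submodule.map_injective_of_injective
        W.injective_subtype (h.trans (Submodule.map_bot _).symm))
      have h1 := hL ⟨w, hw⟩
      rw [h] at h1
      have h2 : (t : ℂ) • S w = 0 := by simpa using h1.symm
      rcases smul_eq_zero.mp h2 with h3 | h3
      · exact absurd (by exact_mod_cast h3) ht.ne'
      · exact absurd h3 hSw
    · intro x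
      have hx : (x : H) ∈ (LinearMap.range L).map W.subtype := h.ge x.2
      obtain ⟨_, ⟨v, rfl⟩, hv⟩ := hx
      exact ⟨v, Subtype.ext hv⟩
  refine hne ⟨LinearIsometryEquiv.ofSurjective Li hsurj, fun a v v' hv => ?_⟩
  change ((L v' : W) : H) = π a (L v : W)
  rw [hL, hL, hv, hS, map_smul]

/-- An operator that commutes with a multiplicity-free representation is scalar on each of its
irreducible summands. -/
theorem exists_eq_smul_of_commute {N : ℕ} {V : Fin N → Submodule ℂ H}
    (hirr : ∀ i, IsIrreducibleSub π (V i)) (hort : ∀ i j, i ≠ j → V i ⟂ V j)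
    (hsup : (⨆ i, V i) = ⊤) (hne : ∀ i j, i ≠ j → ¬ AreEquivalentSubs π (V i) (V j))
    {S : H →L[ℂ] H} (hS : ∀ a v, S (π a v) = π a (S v)) (i : Fin N) :
    ∃ c : ℂ, ∀ v ∈ V i, S v = c • v := by
  -- Schur's lemma kills the component of `S v` in every other block, so `S` preserves `V i`.
  have hoff : ∀ j, j ≠ i → ∀ v ∈ V i, (V j).starProjection (S v) = 0 := by
    intro j hj
    exact (hirr i).eq_zero_of_not_areEquivalentSubs (hirr j) (hne i j hj.symm)
      (S := (V j).starProjection * S)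
      (fun a v => by simp [hS, (hirr j).1.starProjection_comm]) (fun v _ => by simp)
  refine (hirr i).exists_eq_smul (fun a v _ => hS a v) fun v hv => ?_
  have h0 : S v - (V i).starProjection (S v) = 0 := by
    refine eq_zero_of_forall_orthogonal hsup fun j w hw => ?_
    by_cases hj : j = i
    · subst hj
      rw [inner_eq_zero_symm]
      exact Submodule.starProjection_inner_eq_zero _ _ hw
    · have h1 : inner ℂ w ((V i).starProjection (S v)) = 0 :=
        Submodule.isOrtho_iff_inner_eq.mp (hort j i hj) w hw _ (by simp)
      rw [inner_sub_right, h1, sub_zero, ← Submodule.starProjection_eq_self_iff.mpr hw,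
        Submodule.inner_starProjection_left_eq_right, hoff j hj v hv, inner_zero_right]
  rw [sub_eq_zero.mp h0]
  simp

end Schur

/-! ### The density theorem for the represented algebra -/

section Density

variable {A : Type*} [NonUnitalCStarAlgebra A]
variable {H : Type*} [NormedAddCommGroup H] [InnerProductSpace ℂ H] [CompleteSpace H]

/-- The unital algebra of linear maps generated by the range of a representation. -/
def unitalRange (π : A →⋆ₙₐ[ℂ] (H →L[ℂ] H)) : Subalgebra ℂ (Module.End ℂ H) :=
  Algebra.adjoin ℂ (Set.range fun a => (π a : H →ₗ[ℂ] H))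

variable {π : A →⋆ₙₐ[ℂ] (H →L[ℂ] H)}

/-- Scalars plus the range are already closed under products. The scalar is kept separate because
`π` may be degenerate. -/
theorem exists_eq_of_mem_unitalRange {T : Module.End ℂ H} (hT : T ∈ unitalRange π) :
    ∃ (c : ℂ) (a : A), ∀ v, T v = c • v + π a v := by
  induction hT using Algebra.adjoin_induction with
  | mem x hx =>
    obtain ⟨a, rfl⟩ := hx
    exact ⟨0, a, fun v => by simp⟩
  | algebraMap c => exact ⟨c, 0, fun v => by simp [Module.algebraMap_end_apply]⟩
  | add x y _ _ hx hy =>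
    obtain ⟨c, a, h⟩ := hx
    obtain ⟨d, b, h'⟩ := hy
    refine ⟨c + d, a + b, fun v => ?_⟩
    simp only [LinearMap.add_apply, h, h', map_add, add_apply]
    module
  | mul x y _ _ hx hy =>
    obtain ⟨c, a, h⟩ := hx
    obtain ⟨d, b, h'⟩ := hy
    refine ⟨c * d, c • b + d • a + a * b, fun v => ?_⟩
    simp only [Module.End.mul_apply, h, h', map_add, map_mul, map_smul,
      add_apply, smul_apply, mul_apply_eq_comp]
    module

theorem map_mem_unitalRange (a : A) : (π a : H →ₗ[ℂ] H) ∈ unitalRange π :=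
  Algebra.subset_adjoin ⟨a, rfl⟩

/-- An invariant subspace is a submodule over the algebra generated by the representation. -/
def IsInvariant.toSubmodule {W : Submodule ℂ H} (hW : IsInvariant π W) :
    Submodule (unitalRange π) H where
  carrier := W
  add_mem' := W.add_mem
  zero_mem' := W.zero_mem
  smul_mem' := by
    rintro ⟨T, hT⟩ v hv
    obtain ⟨c, a, h⟩ := exists_eq_of_mem_unitalRange hT
    change T v ∈ W
    rw [h]
    exact W.add_mem (W.smul_mem c hv) (hW a v hv)

variable [FiniteDimensional ℂ H]

/-- Orthogonal complements of submodules are submodules; semisimplicity is what Jacobson density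
requires. -/
theorem isSemisimpleModule_unitalRange : IsSemisimpleModule (unitalRange π) H := by
  suffices h : ComplementedLattice (Submodule (unitalRange π) H) from { h with }
  refine ⟨fun W => ?_⟩
  let W' : Submodule ℂ H := W.restrictScalars ℂ
  have hW' : IsInvariant π W' := fun a v hv =>
    W.smul_mem (⟨_, map_mem_unitalRange a⟩ : unitalRange π) hv
  refine ⟨hW'.orthogonal.toSubmodule, ?_⟩
  have hc := Submodule.isCompl_orthogonal W'
  refine ⟨Submodule.disjoint_def.mpr fun x hx hx' =>
    Submodule.disjoint_def.mp hc.disjoint x hx hx', codisjoint_iff.mpr ?_⟩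
  rw [eq_top_iff]
  intro x _
  have hx : x ∈ W' ⊔ W'ᗮ := by rw [hc.sup_eq_top]; exact Submodule.mem_top
  obtain ⟨y, hy, z, hz, rfl⟩ := Submodule.mem_sup.mp hx
  exact Submodule.mem_sup.mpr ⟨y, hy, z, hz, rfl⟩

/-- The operators that preserve the irreducible summands of a multiplicity-free representation
belong, up to a scalar, to its range. -/
theorem exists_eq_smul_one_add_map {N : ℕ} {V : Fin N → Submodule ℂ H}
    (hirr : ∀ i, IsIrreducibleSub π (V i)) (hort : ∀ i j, i ≠ j → V i ⟂ V j)
    (hsup : (⨆ i, V i) = ⊤) (hne : ∀ i j, i ≠ j → ¬ AreEquivalentSubs π (V i) (V j))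
    {T : H →L[ℂ] H} (hT : ∀ i, ∀ v ∈ V i, T v ∈ V i) :
    ∃ (c : ℂ) (a : A), T = c • 1 + π a := by
  classical
  have := isSemisimpleModule_unitalRange (π := π)
  -- The commutant is scalar on each block and `T` preserves blocks, so `T` lies in the bicommutant.
  have hcomm : ∀ (g : Module.End (unitalRange π) H) (x : H), T (g x) = g (T x) := by
    intro g
    have hgsmul : ∀ (c : ℂ) (x : H), g (c • x) = c • g x := fun c x =>
      g.map_smul (algebraMap ℂ (unitalRange π) c) x
    let G : H →L[ℂ] H := LinearMap.toContinuousLinearMap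
      { toFun := g, map_add' := g.map_add, map_smul' := hgsmul }
    have hG : ∀ x, G x = g x := fun _ => rfl
    have hGπ : ∀ a v, G (π a v) = π a (G v) := fun a v =>
      g.map_smul (⟨_, map_mem_unitalRange a⟩ : unitalRange π) v
    have hle : (⨆ i, V i) ≤ LinearMap.eqLocus ((T * G : H →L[ℂ] H) : H →ₗ[ℂ] H)
        ((G * T : H →L[ℂ] H) : H →ₗ[ℂ] H) := by
      refine iSup_le fun i v hv => ?_
      obtain ⟨c, hc⟩ := exists_eq_smul_of_commute hirr hort hsup hne hGπ i
      change T (G v) = G (T v)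
      rw [hc v hv, hc _ (hT i v hv), map_smul]
    rw [hsup] at hle
    exact fun x => hle (Submodule.mem_top (x := x))
  let f : Module.End (Module.End (unitalRange π) H) H :=
    { toFun := T
      map_add' := map_add T
      map_smul' := fun g x => hcomm g x }
  let b := Module.finBasis ℂ H
  -- Density only gives agreement on finite sets; a basis is such a set.
  obtain ⟨r, hr⟩ := jacobson_density f (Finset.univ.image b)
  obtain ⟨c, a, h⟩ := exists_eq_of_mem_unitalRange r.2
  refine ⟨c, a, ContinuousLinearMap.coe_injective <| b.ext fun i => ?_⟩
  exact (hr (b i) (by simp)).trans (h (b i))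

end Density

/-! ### The state space -/

section StateSpace

variable {A : Type*} [NonUnitalCStarAlgebra A]

/-- Since `‖e‖ ≤ 1`, the condition `ω e = 1` already forces `‖ω‖ ≥ 1`; the remaining conditions are
visibly convex. -/
theorem IsUnitElement.mem_stateSpace_iff {e : A} (he : IsUnitElement e) {ω : StrongDual ℂ A} :
    ω ∈ stateSpace A ↔ (∀ a : A, 0 ≤ ω (star a * a)) ∧ ω e = 1 ∧ ‖ω‖ ≤ 1 := by
  refine ⟨fun h => ⟨h.1, h.2.1 e he, h.2.2.le⟩, fun h => ⟨h.1, fun e' he' => ?_, ?_⟩⟩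
  · rw [IsUnitElement.unique he' he, h.2.1]
  · refine le_antisymm h.2.2 ?_
    have h1 := ω.le_opNorm e
    rw [h.2.1, norm_one] at h1
    nlinarith [norm_nonneg ω, he.norm_le_one]

theorem convex_stateSpace [FiniteDimensional ℂ A] : Convex ℝ (stateSpace A) := by
  obtain ⟨e, he⟩ := exists_isUnitElement (A := A)
  intro ω hω ω' hω' s t hs ht hst
  rw [he.mem_stateSpace_iff] at hω hω' ⊢
  refine ⟨fun a => ?_, ?_, ?_⟩
  · exact add_nonneg (smul_nonneg hs (hω.1 a)) (smul_nonneg ht (hω'.1 a))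
  · change s • ω e + t • ω' e = 1
    rw [hω.2.1, hω'.2.1, ← add_smul, hst, one_smul]
  · refine (norm_add_le _ _).trans ?_
    rw [norm_smul, norm_smul, Real.norm_of_nonneg hs, Real.norm_of_nonneg ht]
    nlinarith [hω.2.2, hω'.2.2]

end StateSpace

/-! ### Vector functionals and density matrices -/

section Trace

variable {H : Type*} [NormedAddCommGroup H] [InnerProductSpace ℂ H]

theorem tr_eq_sum_inner {ι : Type*} [Fintype ι] (b : OrthonormalBasis ι ℂ H) (T : H →L[ℂ] H) :
    tr T = ∑ j, inner ℂ (b j) (T (b j)) :=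
  LinearMap.trace_eq_sum_inner _ b

variable [FiniteDimensional ℂ H]

theorem tr_mul_rankOne (T : H →L[ℂ] H) (ψ : H) :
    tr (T * InnerProductSpace.rankOne ℂ ψ ψ) = inner ℂ ψ (T ψ) := by
  rw [tr, ContinuousLinearMap.mul_def, InnerProductSpace.comp_rankOne,
    InnerProductSpace.trace_rankOne]

theorem tr_rankOne_mul (T : H →L[ℂ] H) (ψ : H) :
    tr (InnerProductSpace.rankOne ℂ ψ ψ * T) = inner ℂ ψ (T ψ) := by
  rw [← tr_mul_rankOne]
  exact LinearMap.trace_mul_comm ℂ _ _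

variable [CompleteSpace H]

theorem eq_zero_of_tr_mul_star_eq_zero {S : H →L[ℂ] H} (h : tr (S * star S) = 0) : S = 0 := by
  let b := stdOrthonormalBasis ℂ H
  rw [tr_eq_sum_inner b] at h
  have h1 : ∀ j, inner ℂ (b j) ((S * star S) (b j)) = ((‖star S (b j)‖ ^ 2 : ℝ) : ℂ) := by
    intro j
    rw [mul_apply_eq_comp, ← ContinuousLinearMap.adjoint_inner_left,
      ← ContinuousLinearMap.star_eq_adjoint, inner_self_eq_norm_sq_to_K]
    push_cast
    rfl
  rw [Finset.sum_congr rfl fun j _ => h1 j, ← Complex.ofReal_sum, Complex.ofReal_eq_zero,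
    Finset.sum_eq_zero_iff_of_nonneg fun _ _ => by positivity] at h
  rw [← star_eq_zero]
  refine ContinuousLinearMap.coe_injective (b.toBasis.ext fun j => ?_)
  simpa using h j (Finset.mem_univ j)

end Trace

/-! ### Block representations and the trace pairing -/

section Block

variable {A : Type*} [NonUnitalCStarAlgebra A]
variable {H : Type*} [NormedAddCommGroup H] [InnerProductSpace ℂ H] [CompleteSpace H]

/-- `π` is an injective representation, and the operators preserving the mutually orthogonal
invariant subspaces `V i` belong to its range after multiplication by the image of the unit. -/
structure IsBlockRepresentation (π : A →⋆ₙₐ[ℂ] (H →L[ℂ] H)) (e : A) {N : ℕ}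
    (V : Fin N → Submodule ℂ H) : Prop where
  isUnitElement : IsUnitElement e
  eq_zero : ∀ a, π a = 0 → a = 0
  invariant : ∀ i, IsInvariant π (V i)
  isOrtho : ∀ i j, i ≠ j → V i ⟂ V j
  iSup_eq_top : (⨆ i, V i) = ⊤
  mul_mem_range : ∀ T : H →L[ℂ] H, (∀ i, ∀ v ∈ V i, T v ∈ V i) → T * π e ∈ Set.range π

theorem IsMultiplicityFree.exists_isBlockRepresentation [FiniteDimensional ℂ A]
    [FiniteDimensional ℂ H] {π : A →⋆ₙₐ[ℂ] (H →L[ℂ] H)} (hπ : IsFaithful π)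
    (h : IsMultiplicityFree π) :
    ∃ (e : A) (N : ℕ) (V : Fin N → Submodule ℂ H), IsBlockRepresentation π e V := by
  obtain ⟨e, he⟩ := exists_isUnitElement (A := A)
  obtain ⟨N, V, hirr, hort, hsup, hne⟩ := h
  refine ⟨e, N, V, he, fun a => (hπ a).mp, fun i => (hirr i).1, hort, hsup, fun T hT => ?_⟩
  obtain ⟨c, a, rfl⟩ := exists_eq_smul_one_add_map hirr hort hsup hne hT
  -- Multiplying by `π e` turns the stray scalar `c` into `π (c • e)`.
  refine ⟨c • e + a * e, ?_⟩
  rw [map_add, map_smul, map_mul, add_mul, smul_mul_assoc, one_mul]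

/-- The functional `a ↦ ⟨ψ, π(a) ψ⟩`. -/
def vectorFunctional [FiniteDimensional ℂ A] (π : A →⋆ₙₐ[ℂ] (H →L[ℂ] H)) (ψ : H) :
    StrongDual ℂ A :=
  LinearMap.toContinuousLinearMap
    { toFun := fun a => inner ℂ ψ (π a ψ)
      map_add' := fun a b => by simp
      map_smul' := fun c a => by simp }

/-- The unit vectors in one of the blocks on which the unit of the algebra acts as the identity. -/
def blockVectors (π : A →⋆ₙₐ[ℂ] (H →L[ℂ] H)) (e : A) {N : ℕ} (V : Fin N → Submodule ℂ H) :
    Set H :=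
  {ψ | (∃ i, ψ ∈ V i) ∧ π e ψ = ψ ∧ ‖ψ‖ = 1}

variable {π : A →⋆ₙₐ[ℂ] (H →L[ℂ] H)} {e : A} {N : ℕ} {V : Fin N → Submodule ℂ H}

theorem IsBlockRepresentation.map_unit_mul (h : IsBlockRepresentation π e V) (a : A) :
    π e * π a = π a := by
  rw [← map_mul, (h.isUnitElement a).1]

theorem IsBlockRepresentation.mul_map_unit (h : IsBlockRepresentation π e V) (a : A) :
    π a * π e = π a := by
  rw [← map_mul, (h.isUnitElement a).2]

theorem IsBlockRepresentation.inner_map_unit (h : IsBlockRepresentation π e V) (x y : H) :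
    inner ℂ (π e x) y = inner ℂ x (π e y) := by
  rw [inner_map_left, h.isUnitElement.star_eq]

/-- The projection onto a block vector maps its own block to itself and kills the others; it absorbs
`π e` because `ψ` is fixed. -/
theorem IsBlockRepresentation.rankOne_mem_range (h : IsBlockRepresentation π e V) {ψ : H}
    {i : Fin N} (hψ : ψ ∈ V i) (hψe : π e ψ = ψ) :
    InnerProductSpace.rankOne ℂ ψ ψ ∈ Set.range π := by
  have h1 : InnerProductSpace.rankOne ℂ ψ ψ * π e = InnerProductSpace.rankOne ℂ ψ ψ := by
    ext x
    simp only [mul_apply_eq_comp, InnerProductSpace.rankOne_apply]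
    rw [← h.inner_map_unit, hψe]
  rw [← h1]
  refine h.mul_mem_range _ fun j v hv => ?_
  rw [InnerProductSpace.rankOne_apply]
  by_cases hj : i = j
  · subst hj
    exact (V i).smul_mem _ hψ
  · rw [Submodule.isOrtho_iff_inner_eq.mp (h.isOrtho i j hj) ψ hψ v hv, zero_smul]
    exact (V j).zero_mem

@[simp]
theorem vectorFunctional_apply [FiniteDimensional ℂ A] (ψ : H) (a : A) :
    vectorFunctional π ψ a = inner ℂ ψ (π a ψ) := rfl

theorem IsBlockRepresentation.vectorFunctional_mem_stateSpace [FiniteDimensional ℂ A]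
    (h : IsBlockRepresentation π e V) {ψ : H} (hψ : ψ ∈ blockVectors π e V) :
    vectorFunctional π ψ ∈ stateSpace A := by
  obtain ⟨-, hψe, hψn⟩ := hψ
  refine h.isUnitElement.mem_stateSpace_iff.mpr ⟨fun a => ?_, ?_, ?_⟩
  · rw [vectorFunctional_apply, map_mul, mul_apply_eq_comp, ← inner_map_left]
    rw [inner_self_eq_norm_sq_to_K]
    change (0 : ℂ) ≤ ((‖π a ψ‖ : ℝ) : ℂ) ^ 2
    rw [← Complex.ofReal_pow, Complex.zero_le_real]
    positivity
  · rw [vectorFunctional_apply, hψe, inner_self_eq_norm_sq_to_K, hψn]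
    simp
  · refine ContinuousLinearMap.opNorm_le_bound _ zero_le_one fun a => ?_
    rw [vectorFunctional_apply, one_mul]
    calc ‖inner ℂ ψ (π a ψ)‖ ≤ ‖ψ‖ * ‖π a ψ‖ := norm_inner_le_norm _ _
      _ ≤ ‖ψ‖ * (‖π a‖ * ‖ψ‖) := by gcongr; exact (π a).le_opNorm ψ
      _ = ‖π a‖ := by rw [hψn]; ring
      _ ≤ ‖a‖ := NonUnitalStarAlgHom.norm_apply_le π a

variable [FiniteDimensional ℂ H]

/-- The difference lies in the range, which is closed under adjoints, so it can be tested against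
its own adjoint. -/
theorem eq_of_tr_eq {S T : H →L[ℂ] H}
    (hS : S ∈ Set.range π) (hT : T ∈ Set.range π) (hST : ∀ a, tr (S * π a) = tr (T * π a)) :
    S = T := by
  obtain ⟨s, rfl⟩ := hS
  obtain ⟨t, rfl⟩ := hT
  rw [← sub_eq_zero]
  apply eq_zero_of_tr_mul_star_eq_zero
  rw [← map_sub, ← map_star, map_sub, sub_mul]
  have := hST (star (s - t))
  simp only [tr] at this ⊢
  rw [ContinuousLinearMap.toLinearMap_sub, map_sub, this, sub_self]

/-- Take `b` with `π b = |v⟩⟨v|`. Then `π (b⋆ b) = ‖v‖² π b`, and positivity of `ω` at `b` reads off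
the quadratic form. -/
theorem IsBlockRepresentation.inner_self_nonneg_of_mem (h : IsBlockRepresentation π e V)
    {ω : StrongDual ℂ A} (hω : ω ∈ stateSpace A) {r : A} (hr : ∀ a, ω a = tr (π r * π a))
    {i : Fin N} {v : H} (hv : v ∈ V i) (hve : π e v = v) : 0 ≤ inner ℂ v (π r v) := by
  obtain ⟨b, hb⟩ := h.rankOne_mem_range hv hve
  have h1 : π (star b * b) = ((‖v‖ ^ 2 : ℝ) : ℂ) • π b := by
    rw [map_mul, map_star, hb, ContinuousLinearMap.star_eq_adjoint,
      InnerProductSpace.adjoint_rankOne, ContinuousLinearMap.mul_def,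
      InnerProductSpace.rankOne_comp_rankOne, inner_self_eq_norm_sq_to_K]
    push_cast
    rfl
  have h2 := hω.1 b
  rw [hr, h1, mul_smul_comm, hb] at h2
  have h3 : tr (((‖v‖ ^ 2 : ℝ) : ℂ) • (π r * InnerProductSpace.rankOne ℂ v v)) =
      ((‖v‖ ^ 2 : ℝ) : ℂ) * inner ℂ v (π r v) := by
    rw [← tr_mul_rankOne]
    simp [tr]
  rw [h3] at h2
  by_cases hv0 : v = 0
  · simp [hv0]
  · have h4 : (0 : ℂ) ≤ (((‖v‖ ^ 2)⁻¹ : ℝ) : ℂ) := by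
      rw [Complex.zero_le_real]
      positivity
    have h5 : ((‖v‖ ^ 2 : ℝ) : ℂ) ≠ 0 := by
      rw [Complex.ofReal_ne_zero]
      positivity
    have h6 := mul_nonneg h4 h2
    rwa [← mul_assoc, Complex.ofReal_inv, inv_mul_cancel₀ h5, one_mul] at h6

/-- An orthonormal basis of eigenvectors adapted to the blocks. -/
theorem IsBlockRepresentation.exists_eigenbasis (h : IsBlockRepresentation π e V)
    {T : H →L[ℂ] H} (hT : (T : H →ₗ[ℂ] H).IsSymmetric) (hTV : ∀ i, ∀ v ∈ V i, T v ∈ V i) :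
    ∃ (ι : Type) (_ : Fintype ι) (b : OrthonormalBasis ι ℂ H) (l : ι → ℝ),
      (∀ j, T (b j) = (l j : ℂ) • b j) ∧ ∀ j, ∃ i, b j ∈ V i := by
  have hfam : OrthogonalFamily ℂ (fun i => V i) fun i => (V i).subtypeₗᵢ :=
    OrthogonalFamily.of_pairwise fun i j hij => h.isOrtho i j hij
  have hint : DirectSum.IsInternal V := by
    rw [hfam.isInternal_iff, h.iSup_eq_top, Submodule.top_orthogonal_eq_bot]
  have hs : ∀ i, ((T : H →ₗ[ℂ] H).restrict (hTV i)).IsSymmetric := fun i =>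
    hT.restrict_invariant (hTV i)
  refine ⟨_, inferInstance, hint.collectedOrthonormalBasis hfam
    fun i => (hs i).eigenvectorBasis rfl, fun x => (hs x.1).eigenvalues rfl x.2, fun x => ?_,
    fun x => ⟨x.1, hint.collectedOrthonormalBasis_mem hfam _ x⟩⟩
  have h1 := congrArg Subtype.val ((hs x.1).apply_eigenvectorBasis rfl x.2)
  have h2 : hint.collectedOrthonormalBasis hfam (fun i => (hs i).eigenvectorBasis rfl) x =
      (((hs x.1).eigenvectorBasis rfl x.2 : V x.1) : H) := by
    simp [DirectSum.IsInternal.collectedOrthonormalBasis]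
  rw [h2]
  exact h1

variable [FiniteDimensional ℂ A]

/-- The trace pairing is nondegenerate, so by equality of dimensions it identifies `A` with its
dual. -/
theorem IsBlockRepresentation.exists_tr_eq (h : IsBlockRepresentation π e V)
    (ω : StrongDual ℂ A) : ∃ r : A, ∀ a, ω a = tr (π r * π a) := by
  let Φ : A →ₗ[ℂ] Module.Dual ℂ A := LinearMap.mk₂ ℂ (fun r a => tr (π r * π a))
    (fun a b c => by simp [tr, add_mul]) (fun c a b => by simp [tr])
    (fun a b c => by simp [tr, mul_add]) (fun c a b => by simp [tr])
  have hinj : Function.Injective Φ := by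
    rw [injective_iff_map_eq_zero]
    intro r hr
    refine h.eq_zero r (eq_zero_of_tr_mul_star_eq_zero ?_)
    rw [← map_star]
    exact LinearMap.congr_fun hr (star r)
  have hsurj : Function.Surjective Φ :=
    (LinearMap.injective_iff_surjective_of_finrank_eq_finrank
      (Subspace.dual_finrank_eq (K := ℂ) (V := A)).symm).mp hinj
  obtain ⟨r, hr⟩ := hsurj (ω : A →ₗ[ℂ] ℂ)
  exact ⟨r, fun a => (LinearMap.congr_fun hr a).symm⟩

end Block

/-! ### The density matrix of a state -/

section Eigenbasis

variable {H : Type*} [NormedAddCommGroup H] [InnerProductSpace ℂ H]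
variable {ι : Type*} [Fintype ι]

/-- An orthonormal basis of eigenvectors of `ρ`, with real eigenvalues. -/
structure IsEigenbasis (ρ : H →L[ℂ] H) (b : OrthonormalBasis ι ℂ H)
    (l : ι → ℝ) : Prop where
  apply_eq : ∀ j, ρ (b j) = (l j : ℂ) • b j

variable {ρ : H →L[ℂ] H} {b : OrthonormalBasis ι ℂ H} {l : ι → ℝ}

theorem IsEigenbasis.apply_eq_sum (hb : IsEigenbasis ρ b l) (v : H) :
    ρ v = ∑ j, ((l j : ℂ) * inner ℂ (b j) v) • b j := by
  conv_lhs => rw [← b.sum_repr' v]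
  simp only [map_sum, map_smul, hb.apply_eq, smul_smul, mul_comm]

theorem IsEigenbasis.inner_apply_self (hb : IsEigenbasis ρ b l) (v : H) :
    inner ℂ v (ρ v) = ((∑ j, l j * ‖inner ℂ (b j) v‖ ^ 2 : ℝ) : ℂ) := by
  rw [hb.apply_eq_sum, inner_sum, Complex.ofReal_sum]
  refine Finset.sum_congr rfl fun j _ => ?_
  rw [inner_smul_right, mul_assoc, ← inner_conj_symm v (b j), RCLike.mul_conj]
  push_cast
  rfl

theorem IsEigenbasis.inner_apply_basis (hb : IsEigenbasis ρ b l) (j : ι) :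
    inner ℂ (b j) (ρ (b j)) = (l j : ℂ) := by
  rw [hb.apply_eq, inner_smul_right, inner_self_eq_norm_sq_to_K, b.norm_eq_one]
  simp

theorem IsEigenbasis.nonneg (hb : IsEigenbasis ρ b l) (hρ : ρ.IsPositive)
    (j : ι) : 0 ≤ l j := by
  have := hρ.inner_nonneg_right (b j)
  rwa [hb.inner_apply_basis, Complex.zero_le_real] at this

theorem IsEigenbasis.sum_eq_one (hb : IsEigenbasis ρ b l) (hρ : tr ρ = 1) :
    ∑ j, l j = 1 := by
  rw [tr_eq_sum_inner b, Finset.sum_congr rfl fun j _ => hb.inner_apply_basis j] at hρ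
  exact_mod_cast hρ

end Eigenbasis

section Representative

variable {A : Type*} [NonUnitalCStarAlgebra A]
variable {H : Type*} [NormedAddCommGroup H] [InnerProductSpace ℂ H] [CompleteSpace H]
variable {π : A →⋆ₙₐ[ℂ] (H →L[ℂ] H)} {e : A} {N : ℕ} {V : Fin N → Submodule ℂ H}

theorem IsRepresentative.eq_sum_vectorFunctional [FiniteDimensional ℂ A] {ω : StrongDual ℂ A}
    {ρ : H →L[ℂ] H} (hρ : IsRepresentative π ω ρ) {ι : Type*} [Fintype ι]
    {b : OrthonormalBasis ι ℂ H} {l : ι → ℝ} (hb : IsEigenbasis ρ b l) :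
    ω = ∑ j, l j • vectorFunctional π (b j) := by
  ext a
  rw [hρ.2.2, tr_eq_sum_inner b, sum_apply]
  refine Finset.sum_congr rfl fun j _ => ?_
  rw [mul_apply_eq_comp, ← hρ.1.1.inner_left_eq_inner_right, hb.apply_eq, inner_smul_left]
  simp

theorem vectorFunctional_smul [FiniteDimensional ℂ A] (c : ℂ) (hc : ‖c‖ = 1) (ψ : H) :
    vectorFunctional π (c • ψ) = vectorFunctional π ψ := by
  ext a
  rw [vectorFunctional_apply, vectorFunctional_apply, map_smul, inner_smul_left, inner_smul_right,
    ← mul_assoc, mul_comm _ c, RCLike.mul_conj, hc]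
  simp

variable [FiniteDimensional ℂ H]

/-- Cross terms between blocks vanish, and `π r = π e π r π e` reduces each diagonal term to a block
vector fixed by `π e`. -/
theorem IsBlockRepresentation.isPositive (h : IsBlockRepresentation π e V)
    {ω : StrongDual ℂ A} (hω : ω ∈ stateSpace A) {r : A} (hr : ∀ a, ω a = tr (π r * π a)) :
    (π r).IsPositive := by
  classical
  have hfam : OrthogonalFamily ℂ (fun i => V i) fun i => (V i).subtypeₗᵢ :=
    OrthogonalFamily.of_pairwise fun i j hij => h.isOrtho i j hij
  have hnonneg : ∀ x, 0 ≤ inner ℂ x (π r x) := by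
    intro x
    have hx : ∑ i, (V i).starProjection x = x :=
      hfam.sum_projection_of_mem_iSup x (by rw [h.iSup_eq_top]; exact Submodule.mem_top)
    have hmem : ∀ i, (V i).starProjection x ∈ V i := fun i =>
      Submodule.starProjection_apply_mem _ _
    have h1 : inner ℂ x (π r x) =
        ∑ i, inner ℂ ((V i).starProjection x) (π r ((V i).starProjection x)) := by
      conv_lhs => rw [← hx, sum_inner]
      refine Finset.sum_congr rfl fun i _ => ?_
      rw [map_sum, inner_sum, Finset.sum_eq_single i]
      · intro j _ hj
        exact Submodule.isOrtho_iff_inner_eq.mp (h.isOrtho i j hj.symm) _ (hmem i) _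
          (h.invariant j r _ (hmem j))
      · simp
    rw [h1]
    refine Finset.sum_nonneg fun i _ => ?_
    set v := (V i).starProjection x
    have h2 : π r v = π e (π r (π e v)) :=
      calc π r v = (π e * (π r * π e)) v := by rw [h.mul_map_unit, h.map_unit_mul]
        _ = _ := rfl
    rw [h2, ← h.inner_map_unit]
    refine h.inner_self_nonneg_of_mem hω hr (h.invariant i e v (hmem i)) ?_
    rw [← mul_apply_eq_comp, h.map_unit_mul]
  rw [ContinuousLinearMap.isPositive_iff_complex]
  intro x
  have h1 : (0 : ℂ) ≤ inner ℂ (π r x) x := by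
    rw [← inner_conj_symm]
    exact star_nonneg_iff.mpr (hnonneg x)
  obtain ⟨h2, h3⟩ := Complex.le_def.mp h1
  refine ⟨Complex.ext rfl ?_, h2⟩
  simpa using h3

/-- An eigenvector with nonzero eigenvalue lies in the image of `ρ`, where `π e` acts as the
identity. Kernel vectors need not be fixed by `π e`. -/
theorem IsBlockRepresentation.exists_isEigenbasis (h : IsBlockRepresentation π e V)
    {ω : StrongDual ℂ A} {ρ : H →L[ℂ] H} (hρ : IsRepresentative π ω ρ) :
    ∃ (ι : Type) (_ : Fintype ι) (b : OrthonormalBasis ι ℂ H) (l : ι → ℝ),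
      IsEigenbasis ρ b l ∧ ∀ j, l j ≠ 0 → b j ∈ blockVectors π e V := by
  obtain ⟨⟨hpos, htr⟩, ⟨r, rfl⟩, hω⟩ := hρ
  obtain ⟨ι, hι, b, l, hb, hV⟩ := h.exists_eigenbasis hpos.isSymmetric
    fun i v hv => h.invariant i r v hv
  refine ⟨ι, hι, b, l, ⟨hb⟩, fun j hj => ⟨hV j, ?_, b.norm_eq_one j⟩⟩
  have hj' : (l j : ℂ) ≠ 0 := Complex.ofReal_ne_zero.mpr hj
  have h1 : (l j : ℂ) • π e (b j) = (l j : ℂ) • b j := by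
    rw [← map_smul, ← hb, ← mul_apply_eq_comp, h.map_unit_mul]
  exact smul_right_injective H hj' h1

/-- The density matrix of a combination of functionals. -/
theorem IsRepresentative.eq_sum_smul {ι : Type*} [Fintype ι] {ω : StrongDual ℂ A} {ρ : H →L[ℂ] H}
    (hρ : IsRepresentative π ω ρ) {p : ι → ℝ} {φ : ι → StrongDual ℂ A} {σ : ι → H →L[ℂ] H}
    (hσ : ∀ i, IsRepresentative π (φ i) (σ i)) (hω : ω = ∑ i, p i • φ i) :
    ρ = ∑ i, (p i : ℂ) • σ i := by
  refine eq_of_tr_eq hρ.2.1 ?_ fun a => ?_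
  · choose s hs using fun i => (hσ i).2.1
    refine ⟨∑ i, (p i : ℂ) • s i, ?_⟩
    rw [map_sum]
    exact Finset.sum_congr rfl fun i _ => by rw [map_smul, hs]
  · rw [← hρ.2.2, hω, sum_apply, Finset.sum_mul]
    simp only [tr, ContinuousLinearMap.toLinearMap_sum, map_sum]
    refine Finset.sum_congr rfl fun i _ => ?_
    have := (hσ i).2.2 a
    simp only [tr] at this
    simp [this]

variable [FiniteDimensional ℂ A]

theorem IsBlockRepresentation.exists_isRepresentative (h : IsBlockRepresentation π e V)
    {ω : StrongDual ℂ A} (hω : ω ∈ stateSpace A) : ∃ ρ, IsRepresentative π ω ρ := by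
  obtain ⟨r, hr⟩ := h.exists_tr_eq ω
  refine ⟨π r, ⟨h.isPositive hω hr, ?_⟩, ⟨r, rfl⟩, hr⟩
  rw [← h.mul_map_unit, ← hr, hω.2.1 e h.isUnitElement]

theorem existsUnique_isRepresentative (h : IsBlockRepresentation π e V)
    {ω : StrongDual ℂ A} (hω : ω ∈ stateSpace A) : ∃! ρ, IsRepresentative π ω ρ := by
  obtain ⟨ρ, hρ⟩ := h.exists_isRepresentative hω
  refine ⟨ρ, hρ, fun ρ' hρ' => eq_of_tr_eq hρ'.2.1 hρ.2.1 fun a => ?_⟩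
  rw [← hρ.2.2, ← hρ'.2.2]

theorem IsBlockRepresentation.isRepresentative_rankOne (h : IsBlockRepresentation π e V) {ψ : H}
    (hψ : ψ ∈ blockVectors π e V) :
    IsRepresentative π (vectorFunctional π ψ) (InnerProductSpace.rankOne ℂ ψ ψ) := by
  obtain ⟨⟨i, hi⟩, hψe, hψn⟩ := hψ
  refine ⟨⟨InnerProductSpace.isPositive_rankOne_self ψ, ?_⟩, h.rankOne_mem_range hi hψe,
    fun a => (tr_rankOne_mul (π a) ψ).symm⟩
  rw [tr, InnerProductSpace.trace_rankOne, inner_self_eq_norm_sq_to_K, hψn]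
  simp

/-! ### Pure states -/

/-- A positive summand of `|ψ⟩⟨ψ|` has zero quadratic form on vectors orthogonal to `ψ`, so its
eigenvectors with nonzero eigenvalue are multiples of `ψ`. -/
theorem IsBlockRepresentation.eq_vectorFunctional_of_combination
    (h : IsBlockRepresentation π e V) {ψ : H} (hψ : ψ ∈ blockVectors π e V)
    {ω₁ ω₂ : StrongDual ℂ A} (h₁ : ω₁ ∈ stateSpace A) (h₂ : ω₂ ∈ stateSpace A) {s t : ℝ}
    (hs : 0 < s) (ht : 0 < t) (hω : s • ω₁ + t • ω₂ = vectorFunctional π ψ) :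
    ω₁ = vectorFunctional π ψ := by
  obtain ⟨ρ₁, hρ₁⟩ := h.exists_isRepresentative h₁
  obtain ⟨ρ₂, hρ₂⟩ := h.exists_isRepresentative h₂
  have hsum := (h.isRepresentative_rankOne hψ).eq_sum_smul (ι := Fin 2) (p := ![s, t])
    (φ := ![ω₁, ω₂]) (σ := ![ρ₁, ρ₂]) (by simp [Fin.forall_fin_two, hρ₁, hρ₂]) (by simp [hω])
  simp only [Fin.sum_univ_two, Matrix.cons_val_zero, Matrix.cons_val_one] at hsum
  obtain ⟨ι, _, b, l, hb, -⟩ := h.exists_isEigenbasis hρ₁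
  have hl := hb.nonneg hρ₁.1.1
  have hzero : ∀ v, inner ℂ ψ v = 0 → ∀ j, l j ≠ 0 → inner ℂ (b j) v = 0 := by
    intro v hv j hj
    have h3 : (s : ℂ) * inner ℂ v (ρ₁ v) + t * inner ℂ v (ρ₂ v) = 0 := by
      have := congrArg (fun T : H →L[ℂ] H => inner ℂ v (T v)) hsum
      simpa [inner_add_right, inner_smul_right, hv] using this.symm
    have h4 : (0 : ℂ) ≤ s * inner ℂ v (ρ₁ v) :=
      mul_nonneg (Complex.zero_le_real.mpr hs.le) (hρ₁.1.1.inner_nonneg_right v)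
    have h5 : (0 : ℂ) ≤ t * inner ℂ v (ρ₂ v) :=
      mul_nonneg (Complex.zero_le_real.mpr ht.le) (hρ₂.1.1.inner_nonneg_right v)
    have h6 := ((add_eq_zero_iff_of_nonneg h4 h5).mp h3).1
    have h7 : inner ℂ v (ρ₁ v) = 0 :=
      (mul_eq_zero.mp h6).resolve_left (Complex.ofReal_ne_zero.mpr hs.ne')
    rw [hb.inner_apply_self, Complex.ofReal_eq_zero,
      Finset.sum_eq_zero_iff_of_nonneg fun j _ => mul_nonneg (hl j) (by positivity)] at h7
    simpa [hj] using h7 j (Finset.mem_univ j)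
  have hvec : ∀ j, l j • vectorFunctional π (b j) = l j • vectorFunctional π ψ := by
    intro j
    by_cases hj : l j = 0
    · rw [hj]
      exact (zero_smul ℝ (vectorFunctional π (b j))).trans (zero_smul ℝ (vectorFunctional π ψ)).symm
    congr 1
    have hψψ : inner ℂ ψ ψ = 1 := by
      rw [inner_self_eq_norm_sq_to_K, hψ.2.2]
      simp
    have h8 : inner ℂ ψ (b j - inner ℂ ψ (b j) • ψ) = 0 := by
      rw [inner_sub_right, inner_smul_right, hψψ, mul_one, sub_self]
    -- The part of `b j` orthogonal to `ψ` is orthogonal to both `ψ` and `b j`, hence to itself.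
    have h9 : b j - inner ℂ ψ (b j) • ψ = 0 := by
      rw [← inner_self_eq_zero (𝕜 := ℂ), inner_sub_left, inner_smul_left, h8, hzero _ h8 j hj]
      simp
    have h10 := sub_eq_zero.mp h9
    have h11 : ‖inner ℂ ψ (b j)‖ = 1 := by
      have := congrArg norm h10
      rw [b.norm_eq_one, norm_smul, hψ.2.2, mul_one] at this
      exact this.symm
    rw [h10, vectorFunctional_smul _ h11]
  rw [hρ₁.eq_sum_vectorFunctional hb, Finset.sum_congr rfl fun j _ => hvec j, ← Finset.sum_smul,
    hb.sum_eq_one hρ₁.1.2, one_smul]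

/-- The pure states are the vector states of unit vectors in the blocks. -/
theorem IsBlockRepresentation.pureStates_eq (h : IsBlockRepresentation π e V) :
    pureStates A = vectorFunctional π '' blockVectors π e V := by
  apply Set.Subset.antisymm
  · have hconv : stateSpace A ⊆ convexHull ℝ (vectorFunctional π '' blockVectors π e V) := by
      intro ω hω
      obtain ⟨ρ, hρ⟩ := h.exists_isRepresentative hω
      obtain ⟨ι, _, b, l, hb, hV⟩ := h.exists_isEigenbasis hρ
      classical
      have h1 : ω = ∑ j with l j ≠ 0, l j • vectorFunctional π (b j) := by
        rw [Finset.sum_filter_of_ne]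
        · exact hρ.eq_sum_vectorFunctional hb
        · intro j _ hj hl
          exact hj (by rw [hl]; exact zero_smul ℝ (vectorFunctional π (b j)))
      rw [h1]
      refine (convex_convexHull ℝ _).sum_mem (fun j _ => hb.nonneg hρ.1.1 j) ?_ fun j hj =>
        subset_convexHull ℝ _ ⟨b j, hV j (Finset.mem_filter.mp hj).2, rfl⟩
      rw [Finset.sum_filter_ne_zero]
      exact hb.sum_eq_one hρ.1.2
    have heq : stateSpace A = convexHull ℝ (vectorFunctional π '' blockVectors π e V) :=
      hconv.antisymm (convexHull_min
        (Set.image_subset_iff.mpr fun ψ hψ => h.vectorFunctional_mem_stateSpace hψ)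
        convex_stateSpace)
    rw [pureStates, heq]
    exact extremePoints_convexHull_subset
  · rintro _ ⟨ψ, hψ, rfl⟩
    refine mem_extremePoints_iff_left.mpr ⟨h.vectorFunctional_mem_stateSpace hψ, ?_⟩
    rintro ω₁ h₁ ω₂ h₂ ⟨s, t, hs, ht, -, hω⟩
    exact h.eq_vectorFunctional_of_combination hψ h₁ h₂ hs ht hω

end Representative

/-! ### Entropy inequalities for real numbers -/

section RealInequalities

open Real

/-- The entropy of the eigenvalues `l` of a density matrix is at most the entropy of the weights
`p` of any decomposition; `m i j` is the squared modulus of the component of the `i`-th vector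
along the `j`-th eigenvector. -/
theorem sum_negMulLog_le_sum_negMulLog {α β : Type*} [Fintype α] [Fintype β] {p : α → ℝ}
    {l : β → ℝ} {m : α → β → ℝ} (hp : ∀ i, 0 ≤ p i) (hl : ∀ j, 0 ≤ l j) (hm : ∀ i j, 0 ≤ m i j)
    (hrow : ∀ i, ∑ j, m i j = 1) (hcol : ∀ j, ∑ i, p i * m i j = l j)
    (hinv : ∀ i, p i * ∑ j, m i j / l j ≤ 1) :
    ∑ j, negMulLog (l j) ≤ ∑ i, negMulLog (p i) := by
  have hdom : ∀ i j, p i * m i j ≤ l j := fun i j => by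
    rw [← hcol j]
    exact Finset.single_le_sum (f := fun i => p i * m i j)
      (fun i _ => mul_nonneg (hp i) (hm i j)) (Finset.mem_univ i)
  have h1 : ∑ j, negMulLog (l j) = ∑ i, p i * ∑ j, m i j * -log (l j) := by
    calc ∑ j, negMulLog (l j) = ∑ j, ∑ i, p i * (m i j * -log (l j)) := by
          refine Finset.sum_congr rfl fun j _ => ?_
          rw [negMulLog, neg_mul, ← mul_neg]
          conv_lhs => rw [← hcol j, Finset.sum_mul]
          refine Finset.sum_congr rfl fun i _ => ?_
          rw [hcol j, mul_assoc]
      _ = _ := by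
          rw [Finset.sum_comm]
          simp only [Finset.mul_sum]
  rw [h1]
  refine Finset.sum_le_sum fun i _ => ?_
  rcases (hp i).eq_or_lt with h0 | hpos
  · simp [← h0]
  rw [negMulLog, neg_mul, ← mul_neg]
  refine mul_le_mul_of_nonneg_left ?_ (hp i)
  -- This is `log t ≤ t - 1` at `t = p i / l j`, weighted by `m i j`. Where `l j = 0`, domination
  -- forces `m i j = 0`, so the default value of the quotient is harmless.
  have h2 : ∀ j, m i j * (log (p i) - log (l j)) ≤ p i * (m i j / l j) - m i j := by
    intro j
    rcases (hl j).eq_or_lt with hlj | hlj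
    · have h3 : m i j = 0 := by
        have h4 := hdom i j
        rw [← hlj] at h4
        have h5 := hm i j
        by_contra h6
        have : 0 < m i j := lt_of_le_of_ne h5 (Ne.symm h6)
        nlinarith
      simp [h3]
    · have h3 := Real.log_le_sub_one_of_pos (div_pos hpos hlj)
      rw [Real.log_div hpos.ne' hlj.ne'] at h3
      calc _ ≤ m i j * (p i / l j - 1) := mul_le_mul_of_nonneg_left h3 (hm i j)
        _ = _ := by ring
  have h3 := Finset.sum_le_sum fun j (_ : j ∈ Finset.univ) => h2 j
  rw [Finset.sum_sub_distrib, ← Finset.mul_sum, hrow i] at h3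
  have h4 : ∑ j, m i j * (log (p i) - log (l j)) = log (p i) + ∑ j, m i j * -log (l j) := by
    simp only [mul_sub, Finset.sum_sub_distrib, ← Finset.sum_mul, hrow i, one_mul]
    simp only [mul_neg, Finset.sum_neg_distrib, sub_eq_add_neg]
  linarith [hinv i]

/-- Averaging with a doubly stochastic matrix does not decrease the entropy. -/
theorem sum_negMulLog_le_of_doublyStochastic {α β : Type*} [Fintype α] [Fintype β] {k : α → ℝ}
    {m : α → β → ℝ} (hk : ∀ i, 0 ≤ k i) (hm : ∀ i j, 0 ≤ m i j) (hrow : ∀ i, ∑ j, m i j = 1)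
    (hcol : ∀ j, ∑ i, m i j = 1) :
    ∑ i, negMulLog (k i) ≤ ∑ j, negMulLog (∑ i, k i * m i j) := by
  calc ∑ i, negMulLog (k i) = ∑ j, ∑ i, m i j * negMulLog (k i) := by
        rw [Finset.sum_comm]
        simp only [← Finset.sum_mul, hrow, one_mul]
    _ ≤ _ := by
        refine Finset.sum_le_sum fun j _ => ?_
        have h := concaveOn_negMulLog.le_map_sum (t := Finset.univ) (w := fun i => m i j) (p := k)
          (fun i _ => hm i j) (hcol j) fun i _ => hk i
        simpa only [smul_eq_mul, mul_comm (k _)] using h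

theorem shannonEntropy_eq_sum_negMulLog {n : ℕ} (p : Fin n → ℝ) :
    shannonEntropy p = ∑ i, negMulLog (p i) := by
  simp [shannonEntropy, negMulLog, Finset.sum_neg_distrib]

theorem IsProbVector.shannonEntropy_nonneg {n : ℕ} {p : Fin n → ℝ} (hp : IsProbVector p) :
    0 ≤ shannonEntropy p := by
  rw [shannonEntropy_eq_sum_negMulLog]
  refine Finset.sum_nonneg fun i _ => negMulLog_nonneg (hp.1 i) ?_
  rw [← hp.2]
  exact Finset.single_le_sum (fun j _ => hp.1 j) (Finset.mem_univ i)

end RealInequalities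

/-! ### The von Neumann entropy in terms of eigenvalues -/

section VonNeumann

variable {H : Type*} [NormedAddCommGroup H] [InnerProductSpace ℂ H]

theorem aeval_apply_of_apply_eq_smul {T : H →L[ℂ] H} {x : ℝ} {v : H} (hv : T v = (x : ℂ) • v)
    (q : Polynomial ℝ) : Polynomial.aeval T q v = ((q.eval x : ℝ) : ℂ) • v := by
  induction q using Polynomial.induction_on' with
  | add p q hp hq => simp [hp, hq, add_smul]
  | monomial n c =>
    have hpow : ∀ n : ℕ, (T ^ n) v = ((x : ℂ) ^ n) • v := by
      intro n
      induction n with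
      | zero => simp
      | succ n ih => rw [pow_succ, mul_apply_eq_comp, hv, map_smul, ih, smul_smul, pow_succ']
    rw [Polynomial.aeval_monomial, Polynomial.eval_monomial, mul_apply_eq_comp, hpow,
      Algebra.algebraMap_eq_smul_one]
    simp only [smul_apply, one_apply_eq_self, Complex.coe_smul, map_smul]
    module

variable [FiniteDimensional ℂ H]

theorem finite_real_spectrum (T : H →L[ℂ] H) : (spectrum ℝ T).Finite := by
  have h1 : (spectrum ℂ T).Finite := by
    have h2 := Module.End.finite_spectrum (T : Module.End ℂ H)
    rwa [← AlgEquiv.spectrum_eq (Module.End.toContinuousLinearMap H)] at h2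
  rw [← spectrum.preimage_algebraMap ℂ]
  exact h1.preimage (FaithfulSMul.algebraMap_injective ℝ ℂ).injOn

variable [CompleteSpace H]

/-- The functional calculus acts on eigenvectors. -/
theorem cfc_apply_of_apply_eq_smul {T : H →L[ℂ] H} (hT : IsSelfAdjoint T) (f : ℝ → ℝ) {x : ℝ}
    {v : H} (hv0 : v ≠ 0) (hv : T v = (x : ℂ) • v) : cfc f T v = ((f x : ℝ) : ℂ) • v := by
  have hfin := finite_real_spectrum T
  have hx : x ∈ spectrum ℝ T := by
    rw [spectrum.mem_iff]
    intro hu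
    have h1 : (algebraMap ℝ (H →L[ℂ] H) x - T) v = 0 := by
      rw [sub_apply, hv, Algebra.algebraMap_eq_smul_one]
      simp
    obtain ⟨u, hu⟩ := hu
    have h2 : (↑u⁻¹ * (↑u : H →L[ℂ] H)) v = 0 := by
      rw [mul_apply_eq_comp, hu, h1, map_zero]
    rw [u.inv_mul] at h2
    exact hv0 h2
  -- On the finite spectrum `f` agrees with a polynomial, whose action on eigenvectors is explicit.
  let q : Polynomial ℝ := Lagrange.interpolate hfin.toFinset id f
  have hq : ∀ y ∈ spectrum ℝ T, q.eval y = f y := fun y hy =>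
    Lagrange.eval_interpolate_at_node (v := id) f Function.injective_id.injOn
      (hfin.mem_toFinset.mpr hy)
  rw [cfc_congr (g := fun y => q.eval y) fun y hy => (hq y hy).symm, cfc_polynomial q T hT,
    aeval_apply_of_apply_eq_smul hv, hq x hx]

theorem IsEigenbasis.vonNeumannEntropy_eq {ι : Type*} [Fintype ι] {ρ : H →L[ℂ] H}
    {b : OrthonormalBasis ι ℂ H} {l : ι → ℝ} (hb : IsEigenbasis ρ b l) (hρ : ρ.IsPositive) :
    vonNeumannEntropy ρ = ∑ j, Real.negMulLog (l j) := by
  have h1 : ∀ j, inner ℂ (b j) ((ρ * CFC.log ρ) (b j)) = ((l j * Real.log (l j) : ℝ) : ℂ) := by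
    intro j
    have hj : b j ≠ 0 := b.orthonormal.ne_zero j
    rw [mul_apply_eq_comp, CFC.log,
      cfc_apply_of_apply_eq_smul hρ.isSelfAdjoint Real.log hj (hb.apply_eq j), map_smul,
      inner_smul_right, hb.inner_apply_basis]
    push_cast
    ring
  rw [vonNeumannEntropy, tr_eq_sum_inner b, Finset.sum_congr rfl fun j _ => h1 j,
    ← Complex.ofReal_sum, Complex.ofReal_re, ← Finset.sum_neg_distrib]
  simp [Real.negMulLog]

end VonNeumann

/-! ### The entropy of a state is the von Neumann entropy of its density matrix -/

theorem sum_comp_equiv_subtype {ι M : Type*} [Fintype ι] [AddCommMonoid M] {P : ι → Prop}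
    {n : ℕ} (f : Fin n ≃ {j // P j}) (g : ι → M) (hg : ∀ j, ¬ P j → g j = 0) :
    ∑ i, g (f i) = ∑ j, g j := by
  classical
  rw [f.sum_comp fun j => g j.1,
    ← Finset.sum_subtype (Finset.univ.filter P) (by simp) g, Finset.sum_filter_of_ne]
  exact fun j _ hj => by_contra fun hP => hj (hg j hP)

section Main

variable {A : Type*} [NonUnitalCStarAlgebra A] [FiniteDimensional ℂ A]
variable {H : Type*} [NormedAddCommGroup H] [InnerProductSpace ℂ H] [CompleteSpace H]
variable [FiniteDimensional ℂ H]
variable {π : A →⋆ₙₐ[ℂ] (H →L[ℂ] H)} {e : A} {N : ℕ} {V : Fin N → Submodule ℂ H}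

/-- Comparing the quadratic forms of the spectral and the given mixture yields the overlap matrix
`|⟨bⱼ, ψᵢ⟩|²` together with the bound on `pᵢ ⟨ψᵢ, ρ⁻¹ψᵢ⟩` that the real inequality needs. -/
theorem IsBlockRepresentation.vonNeumannEntropy_le_shannonEntropy
    (h : IsBlockRepresentation π e V) {ω : StrongDual ℂ A} {ρ : H →L[ℂ] H}
    (hρ : IsRepresentative π ω ρ) {n : ℕ} {p : Fin n → ℝ} (hp : IsProbVector p)
    {φ : Fin n → StrongDual ℂ A} (hφ : ∀ i, φ i ∈ pureStates A) (hω : ω = ∑ i, p i • φ i) :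
    vonNeumannEntropy ρ ≤ shannonEntropy p := by
  rw [h.pureStates_eq] at hφ
  choose ψ hψ hψφ using hφ
  obtain ⟨ι, _, b, l, hb, -⟩ := h.exists_isEigenbasis hρ
  have hl := hb.nonneg hρ.1.1
  have hsum := hρ.eq_sum_smul (fun i => hψφ i ▸ h.isRepresentative_rankOne (hψ i)) hω
  have hquad : ∀ v, ∑ j, l j * ‖inner ℂ (b j) v‖ ^ 2 = ∑ i, p i * ‖inner ℂ (ψ i) v‖ ^ 2 := by
    intro v
    have h1 := hb.inner_apply_self v
    have h2 : inner ℂ v (ρ v) = ((∑ i, p i * ‖inner ℂ (ψ i) v‖ ^ 2 : ℝ) : ℂ) := by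
      rw [hsum, sum_apply, inner_sum, Complex.ofReal_sum]
      refine Finset.sum_congr rfl fun i _ => ?_
      rw [smul_apply, InnerProductSpace.rankOne_apply, inner_smul_right, inner_smul_right,
        ← inner_conj_symm v (ψ i), RCLike.mul_conj]
      push_cast
      rfl
    exact_mod_cast h1.symm.trans h2
  rw [hb.vonNeumannEntropy_eq hρ.1.1, shannonEntropy_eq_sum_negMulLog]
  refine sum_negMulLog_le_sum_negMulLog (m := fun i j => ‖inner ℂ (b j) (ψ i)‖ ^ 2) hp.1 hl
    (fun i j => by positivity) (fun i => ?_) (fun j => ?_) (fun i => ?_)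
  · rw [b.sum_sq_norm_inner_right, (hψ i).2.2, one_pow]
  · simp only [norm_inner_symm (b j)]
    rw [← hquad (b j), Finset.sum_eq_single j]
    · rw [inner_self_eq_norm_sq_to_K, b.norm_eq_one]
      simp
    · intro k _ hk
      rw [b.inner_eq_zero hk]
      simp
    · simp
  · set s := ∑ j, ‖inner ℂ (b j) (ψ i)‖ ^ 2 / l j with hs
    -- `v` is `ρ⁻¹ ψᵢ`, with `0⁻¹ = 0` on the kernel. Both `⟨v, ρ v⟩` and `⟨ψᵢ, v⟩` equal `s`, so
    -- `pᵢ |ψᵢ⟩⟨ψᵢ| ≤ ρ` gives `pᵢ s² ≤ s`.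
    let v : H := ∑ j, (((l j)⁻¹ : ℝ) * inner ℂ (b j) (ψ i) : ℂ) • b j
    have hbv : ∀ j, inner ℂ (b j) v = (((l j)⁻¹ : ℝ) * inner ℂ (b j) (ψ i) : ℂ) := fun j =>
      b.orthonormal.inner_right_fintype _ j
    have hleft : ∑ j, l j * ‖inner ℂ (b j) v‖ ^ 2 = s := by
      refine Finset.sum_congr rfl fun j _ => ?_
      rw [hbv, norm_mul, mul_pow, Complex.norm_real, Real.norm_eq_abs, sq_abs]
      rcases eq_or_ne (l j) 0 with h0 | h0
      · simp [h0]
      · field_simp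
    have hψv : inner ℂ (ψ i) v = (s : ℂ) := by
      rw [hs, inner_sum, Complex.ofReal_sum]
      refine Finset.sum_congr rfl fun j _ => ?_
      rw [inner_smul_right, mul_assoc, ← inner_conj_symm (ψ i) (b j), RCLike.mul_conj]
      push_cast
      rw [div_eq_mul_inv, mul_comm]
      rfl
    have hle : p i * s ^ 2 ≤ s := by
      rw [← hleft, hquad v]
      refine le_trans (le_of_eq ?_) (Finset.single_le_sum
        (f := fun k => p k * ‖inner ℂ (ψ k) v‖ ^ 2)
        (fun k _ => mul_nonneg (hp.1 k) (by positivity)) (Finset.mem_univ i))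
      simp only [hψv, Complex.norm_real, Real.norm_eq_abs, sq_abs, ← hquad v, hleft]
    have hs0 : 0 ≤ s := Finset.sum_nonneg fun j _ => div_nonneg (by positivity) (hl j)
    rcases hs0.eq_or_lt with h0 | h0
    · rw [← h0, mul_zero]
      exact zero_le_one
    · by_contra hcon
      push Not at hcon
      nlinarith

/-- The spectral decomposition of the density matrix is an optimal decomposition. -/
theorem IsBlockRepresentation.isLeast_decompositionEntropies
    (h : IsBlockRepresentation π e V) {ω : StrongDual ℂ A} {ρ : H →L[ℂ] H}
    (hρ : IsRepresentative π ω ρ) :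
    IsLeast (decompositionEntropies ω) (vonNeumannEntropy ρ) := by
  classical
  refine ⟨?_, ?_⟩
  · obtain ⟨ι, _, b, l, hb, hV⟩ := h.exists_isEigenbasis hρ
    -- Only nonzero eigenvalues are kept: a kernel vector need not define a state, and its weight
    -- contributes no entropy.
    let f : Fin (Fintype.card {j // l j ≠ 0}) ≃ {j // l j ≠ 0} := (Fintype.equivFin _).symm
    refine ⟨_, fun i => l (f i), fun i => vectorFunctional π (b (f i)),
      ⟨fun i => hb.nonneg hρ.1.1 _, ?_⟩, fun i => ?_, ?_, ?_⟩
    · exact (sum_comp_equiv_subtype f l fun j hj => not_not.mp hj).trans (hb.sum_eq_one hρ.1.2)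
    · rw [h.pureStates_eq]
      exact ⟨_, hV _ (f i).2, rfl⟩
    · have h1 : ∑ i, l (f i) • vectorFunctional π (b (f i)) =
          ∑ j, l j • vectorFunctional π (b j) := by
        refine sum_comp_equiv_subtype f (fun j => l j • vectorFunctional π (b j)) fun j hj => ?_
        rw [not_not.mp hj]
        exact zero_smul ℝ (vectorFunctional π (b j))
      rw [h1]
      exact hρ.eq_sum_vectorFunctional hb
    · rw [shannonEntropy_eq_sum_negMulLog, hb.vonNeumannEntropy_eq hρ.1.1]
      exact (sum_comp_equiv_subtype f (fun j => Real.negMulLog (l j)) fun j hj => by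
          rw [not_not.mp hj, Real.negMulLog_zero]).symm
  · rintro _ ⟨n, p, φ, hp, hφ, hω, rfl⟩
    exact h.vonNeumannEntropy_le_shannonEntropy hρ hp hφ hω

theorem IsBlockRepresentation.entropy_eq (h : IsBlockRepresentation π e V)
    {ω : StrongDual ℂ A} {ρ : H →L[ℂ] H} (hρ : IsRepresentative π ω ρ) :
    entropy ω = vonNeumannEntropy ρ :=
  (h.isLeast_decompositionEntropies hρ).csInf_eq

omit [CompleteSpace H] [FiniteDimensional ℂ H] in
/-- The Peierls inequality: passing to the diagonal in an orthonormal basis does not decrease the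
entropy. -/
theorem IsEigenbasis.sum_negMulLog_le {ι κ : Type*} [Fintype ι] [Fintype κ] {ρ : H →L[ℂ] H}
    {c : OrthonormalBasis κ ℂ H} {k : κ → ℝ} (hc : IsEigenbasis ρ c k) (hk : ∀ i, 0 ≤ k i)
    (b : OrthonormalBasis ι ℂ H) :
    ∑ i, Real.negMulLog (k i) ≤ ∑ j, Real.negMulLog (inner ℂ (b j) (ρ (b j))).re := by
  simp only [hc.inner_apply_self, Complex.ofReal_re]
  refine sum_negMulLog_le_of_doublyStochastic (m := fun i j => ‖inner ℂ (c i) (b j)‖ ^ 2) hk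
    (fun i j => by positivity) (fun i => ?_) (fun j => ?_)
  · rw [b.sum_sq_norm_inner_left, c.norm_eq_one, one_pow]
  · rw [c.sum_sq_norm_inner_right, b.norm_eq_one, one_pow]

/-- In an eigenbasis of the mixture its eigenvalues are mixtures of the diagonals of `ρ₁` and `ρ₂`.
Concavity of `-x log x` applies entrywise, and the Peierls inequality bounds the diagonal entropies
below. -/
theorem IsBlockRepresentation.concaveOn_entropy (h : IsBlockRepresentation π e V) :
    ConcaveOn ℝ (stateSpace A) entropy := by
  refine ⟨convex_stateSpace, fun ω₁ h₁ ω₂ h₂ s t hs ht hst => ?_⟩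
  obtain ⟨ρ₁, hρ₁⟩ := h.exists_isRepresentative h₁
  obtain ⟨ρ₂, hρ₂⟩ := h.exists_isRepresentative h₂
  obtain ⟨ρ, hρ⟩ := h.exists_isRepresentative (convex_stateSpace h₁ h₂ hs ht hst)
  have hsum := hρ.eq_sum_smul (ι := Fin 2) (p := ![s, t])
    (φ := ![ω₁, ω₂]) (σ := ![ρ₁, ρ₂]) (by simp [Fin.forall_fin_two, hρ₁, hρ₂]) (by simp)
  simp only [Fin.sum_univ_two, Matrix.cons_val_zero, Matrix.cons_val_one] at hsum
  obtain ⟨ι, _, b, l, hb, -⟩ := h.exists_isEigenbasis hρ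
  obtain ⟨ι₁, _, b₁, l₁, hb₁, -⟩ := h.exists_isEigenbasis hρ₁
  obtain ⟨ι₂, _, b₂, l₂, hb₂, -⟩ := h.exists_isEigenbasis hρ₂
  rw [h.entropy_eq hρ, h.entropy_eq hρ₁, h.entropy_eq hρ₂, hb.vonNeumannEntropy_eq hρ.1.1,
    hb₁.vonNeumannEntropy_eq hρ₁.1.1, hb₂.vonNeumannEntropy_eq hρ₂.1.1]
  have h3 := hb₁.sum_negMulLog_le (hb₁.nonneg hρ₁.1.1) b
  have h4 := hb₂.sum_negMulLog_le (hb₂.nonneg hρ₂.1.1) b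
  have h5 : ∀ j, l j =
      s • (inner ℂ (b j) (ρ₁ (b j))).re + t • (inner ℂ (b j) (ρ₂ (b j))).re := by
    intro j
    have h6 := congrArg Complex.re (hb.inner_apply_basis j)
    rw [hsum, add_apply, inner_add_right, smul_apply, smul_apply, inner_smul_right,
      inner_smul_right, Complex.add_re, Complex.re_ofReal_mul, Complex.re_ofReal_mul,
      Complex.ofReal_re] at h6
    exact h6.symm
  calc s • ∑ j, Real.negMulLog (l₁ j) + t • ∑ j, Real.negMulLog (l₂ j)
      ≤ s • ∑ j, Real.negMulLog (inner ℂ (b j) (ρ₁ (b j))).re +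
        t • ∑ j, Real.negMulLog (inner ℂ (b j) (ρ₂ (b j))).re :=
        add_le_add (smul_le_smul_of_nonneg_left h3 hs) (smul_le_smul_of_nonneg_left h4 ht)
    _ = ∑ j, (s • Real.negMulLog (inner ℂ (b j) (ρ₁ (b j))).re +
        t • Real.negMulLog (inner ℂ (b j) (ρ₂ (b j))).re) := by
        rw [Finset.smul_sum, Finset.smul_sum, Finset.sum_add_distrib]
    _ ≤ ∑ j, Real.negMulLog (l j) := by
        refine Finset.sum_le_sum fun j _ => ?_
        rw [h5 j]
        refine Real.concaveOn_negMulLog.2 ?_ ?_ hs ht hst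
        · exact (Complex.le_def.mp (hρ₁.1.1.inner_nonneg_right (b j))).1
        · exact (Complex.le_def.mp (hρ₂.1.1.inner_nonneg_right (b j))).1

-- No decomposition has to exist: the real infimum of the empty set is zero.
omit [FiniteDimensional ℂ A] in
theorem entropy_nonneg (ω : StrongDual ℂ A) : 0 ≤ entropy ω := by
  refine Real.sInf_nonneg ?_
  rintro _ ⟨n, p, φ, hp, -, -, rfl⟩
  exact hp.shannonEntropy_nonneg

omit [FiniteDimensional ℂ A] in
theorem entropy_eq_zero_of_mem_pureStates {ω : StrongDual ℂ A} (hω : ω ∈ pureStates A) :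
    entropy ω = 0 := by
  refine le_antisymm (csInf_le ⟨0, ?_⟩ ?_) (entropy_nonneg ω)
  · rintro _ ⟨n, p, φ, hp, -, -, rfl⟩
    exact hp.shannonEntropy_nonneg
  · exact ⟨1, fun _ => 1, fun _ => ω, ⟨fun _ => zero_le_one, by simp⟩, fun _ => hω, by simp,
      by simp [shannonEntropy]⟩

end Main

end CStarEntropy

end

theorem theorem3 {A : Type*} [NonUnitalCStarAlgebra A] [FiniteDimensional ℂ A] :
    -- the infimum that defines the entropy is a genuine one
    (∀ ω ∈ CStarEntropy.stateSpace A,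
      IsGLB (CStarEntropy.decompositionEntropies ω) (CStarEntropy.entropy ω)) ∧
    -- the entropy is nonnegative and concave, and it vanishes on pure states
    (∀ ω ∈ CStarEntropy.stateSpace A, 0 ≤ CStarEntropy.entropy ω) ∧
    ConcaveOn ℝ (CStarEntropy.stateSpace A) CStarEntropy.entropy ∧
    (∀ ω ∈ CStarEntropy.pureStates A, CStarEntropy.entropy ω = 0) ∧
    -- it is the von Neumann entropy of the unique representative in the represented algebra
    (∀ (H : Type*) [NormedAddCommGroup H] [InnerProductSpace ℂ H] [CompleteSpace H]
        [FiniteDimensional ℂ H] (π : A →⋆ₙₐ[ℂ] (H →L[ℂ] H)),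
      CStarEntropy.IsFaithful π → CStarEntropy.IsMultiplicityFree π →
      ∀ ω ∈ CStarEntropy.stateSpace A,
        (∃! ρ : H →L[ℂ] H, CStarEntropy.IsRepresentative π ω ρ) ∧
        ∀ ρ : H →L[ℂ] H, CStarEntropy.IsRepresentative π ω ρ →
          CStarEntropy.entropy ω = CStarEntropy.vonNeumannEntropy ρ) := by
  -- The infimum and concavity claims mention no representation, so an auxiliary one is used; the
  -- last claim uses the given one.
  obtain ⟨K, _, _, _, _, σ, hσ, hmf⟩ := CStarEntropy.exists_faithful_multiplicityFree A
  obtain ⟨e, N, V, h⟩ := hmf.exists_isBlockRepresentation hσ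
  refine ⟨fun ω hω => ?_, fun ω _ => CStarEntropy.entropy_nonneg ω, h.concaveOn_entropy,
    fun ω hω => CStarEntropy.entropy_eq_zero_of_mem_pureStates hω, ?_⟩
  · obtain ⟨ρ, hρ⟩ := h.exists_isRepresentative hω
    rw [h.entropy_eq hρ]
    exact (h.isLeast_decompositionEntropies hρ).isGLB
  · intro H _ _ _ _ π hπ hπmf ω hω
    obtain ⟨e', N', V', h'⟩ := hπmf.exists_isBlockRepresentation hπ
    exact ⟨CStarEntropy.existsUnique_isRepresentative h' hω, fun ρ hρ => h'.entropy_eq hρ⟩
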